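/- Let $V:[0,1]\to\mathbb R$ be Lipschitz continuous and nonincreasing, let $\varepsilon>0$, and let $\gamma(z)=e^{z}\mathbf 1_{(-\infty,0]}(z)$ be the exponential kernel. For $\rho:[0,\infty)\times\mathbb R\to\mathbb R$ bounded, put $$W_\varepsilon[\rho](t,x)=\frac1\varepsilon\int_x^\infty \gamma\Big(\frac{x-y}{\varepsilon}\Big)\rho(t,y)\,dy,\qquad t\ge 0,\ x\in\mathbb R .$$ Let $\rho_0,\widetilde\rho_0\in L^\infty(\mathbb R)$ satisfy $0\le\rho_0,\widetilde\rho_0\le1$ a.e., $\mathrm{TV}(\rho_0)<\infty$, $\mathrm{TV}(\widetilde\rho_0)<\infty$ and $\rho_0-\widetilde\rho_0\in L^1(\mathbb R)$. Let $\rho_\varepsilon$ and $\widetilde\rho_\varepsilon$ be weak solutions on $[0,\infty)\times\mathbb R$, with initial data $\rho_0$ and $\widetilde\rho_0$ respectively, of the nonlocal conservation law $$\partial_t\rho+\partial_x\big(V(W_\varepsilon[\rho])\,\rho\big)=0 .$$ Here a weak solution with initial datum $\rho_0$ is a bounded measurable $\rho$, continuous in time with values in $L^\infty(\mathbb R)$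 with its weak-$*$ topology (in particular, every bounded $\rho\in C([0,\infty);L^1_{\mathrm{loc}}(\mathbb R))$ is admitted), such that $W_\varepsilon[\rho]$ takes values in the domain $[0,1]$ of $V$ and $$\int_0^\infty\!\!\int_{\mathbb R}\rho\,\partial_t\varphi+V(W_\varepsilon[\rho])\,\rho\,\partial_x\varphi\;dx\,dt+\int_{\mathbb R}\rho_0(x)\varphi(0,x)\,dx=0\qquad\text{for all }\varphi\in C_c^\infty(\mathbb R^2).$$ Write $W_\varepsilon=W_\varepsilon[\rho_\varepsilon]$ and $\widetilde W_\varepsilon=W_\varepsilon[\widetilde\rho_\varepsilon]$. Then, for every $t\ge0$, $W_\varepsilon(t,\cdot)-\widetilde W_\varepsilon(t,\cdot)\in L^1(\mathbb R)$ and $$\|W_\varepsilon(t,\cdot)-\widetilde W_\varepsilon(t,\cdot)\|_{L^1(\mathbb R)}\le\|W_\varepsilon(0,\cdot)-\widetilde W_\varepsilon(0,\cdot)\|_{L^1(\mathbb R)} .$$ -/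

import Mathlib

open MeasureTheory Set
open scoped ENNReal ContDiff

noncomputable section

/-- The total variation of (the a.e.-equivalence class of) a function on the real line:
the least pointwise variation among its representatives. -/
def essVariation (f : ℝ → ℝ) : ℝ≥0∞ :=
  ⨅ g : {g : ℝ → ℝ // g =ᵐ[volume] f}, eVariationOn g.1 univ

/-- Admissible initial densities: `ρ₀ ∈ L^∞(ℝ)`, `0 ≤ ρ₀ ≤ 1`, `TV(ρ₀) < ∞`. -/
structure IsInitialDatum (ρ₀ : ℝ → ℝ) : Prop where
  memLp_top : MemLp ρ₀ ⊤ volume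
  mem_Icc : ∀ᵐ x, ρ₀ x ∈ Icc (0 : ℝ) 1
  finite_variation : essVariation ρ₀ < ⊤

/-- Admissible velocity functions: Lipschitz continuous and nonincreasing on `[0, 1]`.
The values of `V` outside `[0, 1]` play no role. -/
structure IsVelocity (V : ℝ → ℝ) : Prop where
  lipschitz : ∃ K, LipschitzOnWith K V (Icc 0 1)
  antitone : AntitoneOn V (Icc 0 1)

/-- The exponential kernel: `exp z` for `z ≤ 0`, and `0` for `z > 0`. -/
def expKernel : ℝ → ℝ := indicator (Iic 0) Real.exp

/-- The nonlocal impact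
`W_ε[ρ](t, x) = (1/ε) ∫_x^∞ γ((x - y)/ε) ρ(t, y) dy`. -/
def nonlocalImpact (γ : ℝ → ℝ) (ε : ℝ) (ρ : ℝ → ℝ → ℝ) (t x : ℝ) : ℝ :=
  1 / ε * ∫ y in Ioi x, γ ((x - y) / ε) * ρ t y

/-- `ρ` is a (bounded, weakly-* continuous in time) distributional solution on `[0, ∞) × ℝ` of
`∂ₜ ρ + ∂ₓ (V(W_ε[ρ]) ρ) = 0`, `ρ(0, ·) = ρ₀`. Only the values `ρ t x` with `t ≥ 0` matter. -/
structure IsWeakSolution (γ V : ℝ → ℝ) (ε : ℝ) (ρ₀ : ℝ → ℝ) (ρ : ℝ → ℝ → ℝ) : Prop where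
  aestronglyMeasurable :
    AEStronglyMeasurable (fun p : ℝ × ℝ => ρ p.1 p.2) (volume.restrict (Ioi 0 ×ˢ univ))
  aestronglyMeasurable_slice : ∀ t, 0 ≤ t → AEStronglyMeasurable (ρ t) volume
  bounded : ∃ M : ℝ, ∀ t, 0 ≤ t → ∀ᵐ x, |ρ t x| ≤ M
  /-- `t ↦ ρ(t, ·)` is continuous from `[0, ∞)` to `L^∞(ℝ) = (L¹(ℝ))'` with the
  weak-* topology. It fixes the value of `ρ(t, ·)` as an element of `L^∞(ℝ)` at every time. -/
  continuous_weakStar : ∀ g : ℝ → ℝ, Integrable g volume →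
    ContinuousOn (fun t => ∫ x, ρ t x * g x) (Ici 0)
  /-- The impact lies in `[0, 1]`, the domain of the velocity function. -/
  impact_mem_Icc : ∀ t, 0 ≤ t → ∀ x, nonlocalImpact γ ε ρ t x ∈ Icc (0 : ℝ) 1
  /-- The weak formulation. The test functions need not vanish at `t = 0`; `fderiv ℝ φ p (1, 0)`
  and `fderiv ℝ φ p (0, 1)` are the time and the space derivative of `φ`. -/
  weak_eq : ∀ φ : ℝ × ℝ → ℝ, ContDiff ℝ ∞ φ → HasCompactSupport φ →
    (∫ p in (Ioi (0 : ℝ)) ×ˢ (univ : Set ℝ),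
        (ρ p.1 p.2 * fderiv ℝ φ p (1, 0) +
          V (nonlocalImpact γ ε ρ p.1 p.2) * ρ p.1 p.2 * fderiv ℝ φ p (0, 1))) +
      ∫ x, ρ₀ x * φ (0, x) = 0

end

/-! For the exponential kernel, the averaging operator `A = expAverage ε` is the resolvent `(1 - ε
∂ₓ)⁻¹`, so the density is recovered from its impact by `ρ = W - ε ∂ₓW`. Let `P` be the primitive of
`V` and `R(w) = V(w) w - P(w)`. Then `V(W) ρ = V(W) W - ε ∂ₓ P(W)`, and applying `A` to the
conservation law, with `A(ε ∂ₓ P) = A P - P`, gives an equation in `W` alone: `∂ₜW + ∂ₓ(P(W) + A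
R(W)) = 0`, that is, `∂ₜW + V(W) ∂ₓW = (R(W) - A R(W)) / ε`.

The impact is Lipschitz in `x` and, for almost every `x`, Lipschitz in `t`. Hence the difference of
two such equations can be multiplied by `sign(W - W̃)` pointwise, without doubling of variables. The
transport part becomes the derivative of the Kružkov flux `P(max) - P(min)`. Since `V` is
nonincreasing, so is `R` on `[0, ∞)`; with `k = R(W) - R(W̃)` this gives `sign(W - W̃) k = -|k|`, so
the source is at most `(A|k| - |k|) / ε`. Formally its integral is zero, because `A` preserves mass,
and the `L¹` distance cannot grow.

Integrability of `W - W̃` at positive times is part of the conclusion, so the computation is done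
with the weight `exp(-δ|x|)`. The weight costs errors of order `δ`
(`integral_sign_mul_deriv_impactFlux_le`), Grönwall's inequality bounds the growth by `exp((L + 4K)
δ t)`, and Fatou's lemma removes the weight as `δ → 0` (`IsImpactSolution.eLpNorm_sub_le`). The
passage from weak solutions to the equation for `W` is `IsWeakSolution.isImpactSolution`. -/

/-! ### Weak derivatives on the line and the half-line -/

/-- The du Bois-Reymond lemma: a locally integrable function with vanishing distributional
derivative is almost everywhere constant. -/
theorem ae_eq_const_of_integral_mul_deriv_eq_zero {n : ℝ → ℝ} (hn : LocallyIntegrable n)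
    (h : ∀ ζ : ℝ → ℝ, ContDiff ℝ ∞ ζ → HasCompactSupport ζ → ∫ x, n x * deriv ζ x = 0) :
    ∃ c, ∀ᵐ x, n x = c := by
  let β : ContDiffBump (0 : ℝ) := default
  set η := β.normed volume with hη
  have ηs : ContDiff ℝ ∞ η := β.contDiff_normed
  have ηc : HasCompactSupport η := β.hasCompactSupport_normed
  have ηi : ∫ x, η x = 1 := β.integral_normed
  refine ⟨∫ x, η x * n x, ?_⟩
  have key := ae_eq_zero_of_integral_contDiff_smul_eq_zero (μ := volume)
    (f := fun x => n x - ∫ x, η x * n x) (hn.sub (locallyIntegrable_const _)) ?_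
  · filter_upwards [key] with x hx using sub_eq_zero.1 hx
  intro g gs gc
  -- Subtracting a multiple of the unit-mass bump `η` makes the mean zero; this is exactly what lets
  -- the primitive `ζ` of `φ` have compact support.
  set φ : ℝ → ℝ := fun x => g x - (∫ y, g y) * η x with hφ
  have φs : ContDiff ℝ ∞ φ := gs.sub (contDiff_const.mul ηs)
  have φc : HasCompactSupport φ := gc.sub ηc.mul_left
  have gi : Integrable g := gs.continuous.integrable_of_hasCompactSupport gc
  have ηint : Integrable η := ηs.continuous.integrable_of_hasCompactSupport ηc
  have φi : ∫ x, φ x = 0 := by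
    rw [hφ, integral_sub gi (ηint.const_mul _), integral_const_mul, ηi]; ring
  obtain ⟨R, hR⟩ := φc.isBounded.subset_ball (0 : ℝ)
  have φz : ∀ x, R ≤ |x| → φ x = 0 := fun x hx => by
    by_contra hne
    have := hR (subset_tsupport _ hne)
    simp only [mem_ball_zero_iff, Real.norm_eq_abs] at this
    linarith
  have hsupp : Function.support φ ⊆ Ioc (-R) R := fun x hx => by
    have : |x| < R := by
      by_contra hne
      exact hx (φz x (not_lt.1 hne))
    exact ⟨(abs_lt.1 this).1, (abs_lt.1 this).2.le⟩
  set ζ : ℝ → ℝ := fun x => ∫ t in (-R)..x, φ t with hζ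
  have hd : ∀ x, HasDerivAt ζ (φ x) x := fun x =>
    intervalIntegral.integral_hasDerivAt_right (φs.continuous.intervalIntegrable _ _)
      (φs.continuous.stronglyMeasurableAtFilter _ _) φs.continuous.continuousAt
  have hdζ : deriv ζ = φ := funext fun x => (hd x).deriv
  have ζs : ContDiff ℝ ∞ ζ :=
    contDiff_infty_iff_deriv.2 ⟨fun x => (hd x).differentiableAt, hdζ ▸ φs⟩
  have ζc : HasCompactSupport ζ := by
    refine HasCompactSupport.intro (isCompact_Icc (a := -R) (b := R)) fun x hx => ?_
    rw [mem_Icc, not_and_or, not_le, not_le] at hx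
    rcases hx with hx | hx
    · rw [hζ]
      dsimp only
      rw [intervalIntegral.integral_congr (g := fun _ => (0 : ℝ)), intervalIntegral.integral_zero]
      intro y hy
      rw [uIcc_of_ge hx.le, mem_Icc] at hy
      refine φz y ?_
      rw [← abs_neg]
      exact le_trans (by linarith) (le_abs_self _)
    · rw [hζ]
      dsimp only
      rw [intervalIntegral.integral_eq_integral_of_support_subset, φi]
      exact hsupp.trans (Ioc_subset_Ioc_right hx.le)
  have h0 := h ζ ζs ζc
  rw [hdζ] at h0
  have gn : Integrable fun x => g x * n x :=
    hn.integrable_smul_left_of_hasCompactSupport gs.continuous gc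
  have ηn : Integrable fun x => η x * n x :=
    hn.integrable_smul_left_of_hasCompactSupport ηs.continuous ηc
  have e1 : ∫ x, n x * φ x = (∫ x, g x * n x) - (∫ y, g y) * ∫ x, η x * n x := by
    rw [← integral_const_mul, ← integral_sub gn (ηn.const_mul _)]
    exact integral_congr_ae (Filter.Eventually.of_forall fun x => by simp only [hφ]; ring)
  simp only [smul_eq_mul, mul_sub]
  rw [integral_sub gn (gi.mul_const _), integral_mul_const]
  linarith

theorem AbsolutelyContinuousOnInterval.of_lipschitz {f : ℝ → ℝ} {C : NNReal}
    (hf : LipschitzWith C f) (a b : ℝ) : AbsolutelyContinuousOnInterval f a b :=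
  (hf.lipschitzOnWith).absolutelyContinuousOnInterval

/-- The weak form, on the half-line, of `a' = b`, `a 0 = c`. -/
theorem eq_add_integral_of_weak_deriv {a b : ℝ → ℝ} {c : ℝ} (ha : ContinuousOn a (Ici 0))
    (hb : LocallyIntegrable (indicator (Ioi 0) b))
    (h : ∀ χ : ℝ → ℝ, ContDiff ℝ ∞ χ → HasCompactSupport χ →
      (∫ t in Ioi 0, (a t * deriv χ t + b t * χ t)) + c * χ 0 = 0) {t : ℝ} (ht : 0 ≤ t) :
    a t = c + ∫ s in 0..t, b s := by
  set b' := indicator (Ioi 0) b with hb'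
  have bii : ∀ x y, IntervalIntegrable b' volume x y := fun x y =>
    (hb.integrableOn_isCompact isCompact_uIcc).intervalIntegrable
  set B : ℝ → ℝ := fun t => c + ∫ s in 0..t, b' s with hB
  have Bc : Continuous B :=
    continuous_const.add (intervalIntegral.continuous_primitive (fun x y => bii x y) 0)
  -- The difference is extended by zero to negative times. Because the test functions see `t = 0`
  -- through `c * χ 0`, the extension creates no jump there, and its distributional derivative
  -- vanishes on the whole line.
  set n : ℝ → ℝ := indicator (Ioi 0) (fun t => a t - B t) with hn
  have hcont : ContinuousOn (fun t => a t - B t) (Ici 0) := ha.sub Bc.continuousOn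
  have nloc : LocallyIntegrable n := by
    have hac : Continuous fun t => a (max t 0) := ha.comp_continuous (by fun_prop)
      fun t => mem_Ici.2 (le_max_right _ _)
    refine LocallyIntegrable.congr (f := indicator (Ioi 0) fun t => a (max t 0) - B t)
      ((hac.sub Bc).locallyIntegrable.indicator measurableSet_Ioi)
      (Filter.Eventually.of_forall fun t => ?_)
    simp only [hn, indicator]
    split_ifs with h0
    · simp [max_eq_left (le_of_lt (mem_Ioi.1 h0))]
    · rfl
  obtain ⟨c', hc'⟩ := ae_eq_const_of_integral_mul_deriv_eq_zero nloc (fun χ χs χc => by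
    obtain ⟨R, hR⟩ := χc.isBounded.subset_ball (0 : ℝ)
    have χz : ∀ x, R ≤ |x| → χ x = 0 := fun x hx => by
      by_contra hne
      have := hR (subset_tsupport _ hne)
      simp only [mem_ball_zero_iff, Real.norm_eq_abs] at this
      linarith
    set T := max R 0 with hT
    have hT0 : 0 ≤ T := le_max_right _ _
    have χT : ∀ x, T ≤ x → χ x = 0 := fun x hx =>
      χz x ((le_max_left _ _).trans (hx.trans (le_abs_self _)))
    have dχc : HasCompactSupport (deriv χ) := χc.deriv
    have dχs : Continuous (deriv χ) := χs.continuous_deriv (by simp)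
    have dχT : ∀ x, T < x → deriv χ x = 0 := fun x hx => by
      have : χ =ᶠ[nhds x] fun _ => 0 := by
        filter_upwards [Ioi_mem_nhds hx] with y hy using χT y (le_of_lt hy)
      rw [this.deriv_eq]; simp
    have restr : ∀ f : ℝ → ℝ, (∀ x, T < x → f x = 0) →
        ∫ x in Ioi 0, f x = ∫ x in 0..T, f x := fun f hf => by
      rw [intervalIntegral.integral_of_le hT0]
      refine setIntegral_eq_of_subset_of_forall_sdiff_eq_zero measurableSet_Ioi
        (fun x hx => hx.1) (fun x hx => hf x ?_)
      by_contra hle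
      exact hx.2 ⟨hx.1, not_lt.1 hle⟩
    have Bac : AbsolutelyContinuousOnInterval B 0 T := by
      have h1 := (bii 0 T).absolutelyContinuousOnInterval_intervalIntegral (c := 0) (by simp)
      exact (AbsolutelyContinuousOnInterval.of_lipschitz (LipschitzWith.const c) 0 T).add h1
    have χac : AbsolutelyContinuousOnInterval χ 0 T := by
      obtain ⟨C, hC⟩ := ContDiff.lipschitzWith_of_hasCompactSupport χc χs (by simp)
      exact .of_lipschitz hC 0 T
    have ibp := Bac.integral_mul_deriv_eq_deriv_mul χac
    have dB : ∫ x in 0..T, deriv B x * χ x = ∫ x in 0..T, b x * χ x := by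
      refine intervalIntegral.integral_congr_ae ?_
      filter_upwards [(bii 0 T).ae_hasDerivAt_integral] with x hx hxT
      rw [uIoc_of_le hT0] at hxT
      have h2 := ((hx (by rw [uIcc_of_le hT0]; exact Ioc_subset_Icc_self hxT) 0
        (by simp)).const_add c).deriv
      rw [show deriv B x = b' x from h2, hb', indicator_of_mem (show x ∈ Ioi 0 from hxT.1)]
    rw [dB, χT T le_rfl] at ibp
    have B0 : B 0 = c := by simp [hB]
    rw [B0] at ibp
    have e1 : ∫ x, n x * deriv χ x = ∫ x in 0..T, (a x - B x) * deriv χ x := by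
      rw [← restr _ (fun x hx => by rw [dχT x hx, mul_zero]), ← integral_indicator measurableSet_Ioi]
      congr 1
      ext x
      simp only [hn, indicator]
      split_ifs <;> simp
    have hχ := h χ χs χc
    rw [restr _ (fun x hx => by rw [dχT x hx, χT x hx.le]; ring)] at hχ
    have aii : IntervalIntegrable (fun x => a x * deriv χ x) volume 0 T :=
      ((ha.mono (by rw [uIcc_of_le hT0]; exact Icc_subset_Ici_self)).mul
        dχs.continuousOn).intervalIntegrable
    have bχ : IntervalIntegrable (fun x => b x * χ x) volume 0 T := by
      refine ((bii 0 T).mul_continuousOn χs.continuous.continuousOn).congr_ae ?_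
      refine (ae_restrict_iff' measurableSet_uIoc).2 (Filter.Eventually.of_forall fun x hx => ?_)
      rw [uIoc_of_le hT0] at hx
      simp only [hb', indicator_of_mem (show x ∈ Ioi 0 from hx.1)]
    rw [intervalIntegral.integral_add aii bχ] at hχ
    rw [e1]
    simp only [sub_mul]
    rw [intervalIntegral.integral_sub aii (Continuous.intervalIntegrable (by fun_prop) _ _)]
    linarith)
  -- The constant is read off on the negative half-line, where `n` is zero by construction.
  have c0 : c' = 0 := by
    have h1 : ∀ᵐ x ∂(volume.restrict (Iio (0:ℝ))), c' = 0 := by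
      filter_upwards [ae_restrict_of_ae hc', ae_restrict_mem measurableSet_Iio] with x hx hx0
      rw [← hx, hn, indicator_of_notMem (by simpa using (le_of_lt hx0 : x ≤ 0))]
    have : (volume.restrict (Iio (0:ℝ))) ≠ 0 := by simp
    have : (ae (volume.restrict (Iio (0:ℝ)))).NeBot := ae_neBot.2 this
    exact h1.exists.choose_spec
  subst c0
  have hae : ∀ᵐ x ∂(volume.restrict (Ici (0:ℝ))), a x - B x = 0 := by
    rw [← restrict_Ioi_eq_restrict_Ici]
    filter_upwards [ae_restrict_of_ae hc', ae_restrict_mem measurableSet_Ioi] with x hx hx0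
    rwa [hn, indicator_of_mem hx0] at hx
  have hall : EqOn (fun x => a x - B x) (fun _ => 0) (Ici 0) := by
    refine Measure.eqOn_of_ae_eq (μ := volume) hae hcont continuousOn_const ?_
    rw [interior_Ici, closure_Ioi]
  have := hall ht
  simp only [sub_eq_zero] at this
  rw [this, hB]
  dsimp only
  congr 1
  refine intervalIntegral.integral_congr_ae (Filter.Eventually.of_forall fun x hx => ?_)
  rw [uIoc_of_le ht] at hx
  rw [hb', indicator_of_mem (show x ∈ Ioi 0 from hx.1)]

/-! ### Sign function and chain rule for the absolute value -/

theorem Real.abs_eq_sign_mul (x : ℝ) : |x| = Real.sign x * x := by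
  rcases lt_trichotomy x 0 with h | h | h
  · rw [Real.sign_of_neg h, abs_of_neg h]; ring
  · simp [h]
  · rw [Real.sign_of_pos h, abs_of_pos h]; ring

theorem Real.abs_sign_le (x : ℝ) : |Real.sign x| ≤ 1 := by
  rcases Real.sign_apply_eq x with h | h | h <;> simp [h]

theorem Real.measurable_sign' : Measurable Real.sign := by
  have : Real.sign = fun r : ℝ => if r < 0 then -1 else if 0 < r then 1 else (0 : ℝ) := by
    ext r; rfl
  rw [this]
  exact Measurable.ite measurableSet_Iio measurable_const
    (Measurable.ite measurableSet_Ioi measurable_const measurable_const)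

theorem deriv_abs_eq_sign_mul {e : ℝ → ℝ} {e' x : ℝ} (he : HasDerivAt e e' x) :
    deriv (fun s => |e s|) x = Real.sign (e x) * e' := by
  rcases lt_trichotomy (e x) 0 with h | h | h
  · have : (fun s => |e s|) =ᶠ[nhds x] fun s => -e s := by
      filter_upwards [he.continuousAt.eventually_lt continuousAt_const h] with y hy
        using abs_of_neg hy
    rw [this.deriv_eq, he.fun_neg.deriv, Real.sign_of_neg h]; ring
  -- At a zero of `e` the absolute value has a minimum, so `deriv` is zero whether or not it is
  -- differentiable there; this matches `Real.sign 0 = 0`.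
  · have : IsLocalMin (fun s => |e s|) x :=
      Filter.Eventually.of_forall fun y => by simp [h]
    rw [this.deriv_eq_zero, h, Real.sign_zero, zero_mul]
  · have : (fun s => |e s|) =ᶠ[nhds x] e := by
      filter_upwards [continuousAt_const.eventually_lt he.continuousAt h] with y hy
        using abs_of_pos hy
    rw [this.deriv_eq, he.deriv, Real.sign_of_pos h]; ring

/-- The chain rule for the absolute value along a Lipschitz primitive. -/
theorem abs_eq_abs_add_integral_sign_mul {d h : ℝ → ℝ} {C t : ℝ} (ht : 0 ≤ t)
    (hm : Measurable h) (hC : ∀ s, |h s| ≤ C)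
    (hd : ∀ s, 0 ≤ s → d s = d 0 + ∫ r in 0..s, h r) :
    |d t| = |d 0| + ∫ s in 0..t, Real.sign (d s) * h s := by
  have hC0 : 0 ≤ C := (abs_nonneg _).trans (hC 0)
  have hii : ∀ x y, IntervalIntegrable h volume x y := fun x y =>
    (intervalIntegrable_const (c := C)).mono_fun hm.aestronglyMeasurable
      (Filter.Eventually.of_forall fun s => by
        simpa [abs_of_nonneg hC0] using hC s)
  -- `d` is controlled only for nonnegative times; `e` agrees with it there and is Lipschitz on the
  -- whole line.
  set e : ℝ → ℝ := fun s => d 0 + ∫ r in 0..s, h r with he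
  have elip : LipschitzWith C.toNNReal e := by
    refine LipschitzWith.of_dist_le_mul fun x y => ?_
    rw [Real.dist_eq, Real.dist_eq, Real.coe_toNNReal _ hC0, he]
    dsimp only
    rw [add_sub_add_left_eq_sub, intervalIntegral.integral_interval_sub_left (hii _ _) (hii _ _)]
    exact intervalIntegral.norm_integral_le_of_norm_le_const (f := h) fun s _ => hC s
  have alip : LipschitzWith C.toNNReal (fun s => |e s|) := by
    have := lipschitzWith_one_norm.comp elip
    rwa [one_mul] at this
  have h1 := (AbsolutelyContinuousOnInterval.of_lipschitz alip 0 t).integral_deriv_eq_sub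
  have h2 : ∫ s in 0..t, deriv (fun s => |e s|) s = ∫ s in 0..t, Real.sign (d s) * h s := by
    refine intervalIntegral.integral_congr_ae ?_
    filter_upwards [(hii 0 t).ae_hasDerivAt_integral] with x hx hxt
    rw [uIoc_of_le ht] at hxt
    have hde : HasDerivAt e (h x) x :=
      (hx (by rw [uIcc_of_le ht]; exact Ioc_subset_Icc_self hxt) 0 (by simp)).const_add _
    rw [deriv_abs_eq_sign_mul hde, hd x hxt.1.le]
  rw [h2] at h1
  have e0 : e 0 = d 0 := by simp [he]
  have et : e t = d t := (hd t ht).symm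
  simp only [e0, et] at h1
  linarith

/-! ### Integration by parts and Grönwall's inequality -/

/-- The integral of the derivative of a function vanishing at infinity is zero. -/
theorem integral_deriv_eq_zero_of_tendsto {u : ℝ → ℝ}
    (hu : ∀ a b, AbsolutelyContinuousOnInterval u a b) (hi : Integrable (deriv u))
    (h1 : Filter.Tendsto u Filter.atTop (nhds 0)) (h2 : Filter.Tendsto u Filter.atBot (nhds 0)) :
    ∫ x, deriv u x = 0 := by
  have A := intervalIntegral_tendsto_integral hi (a := fun R : ℝ => -R) (b := fun R => R)
    Filter.tendsto_neg_atTop_atBot Filter.tendsto_id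
  have B : Filter.Tendsto (fun R : ℝ => ∫ x in (-R)..R, deriv u x) Filter.atTop (nhds (0 - 0)) := by
    simp only [(hu _ _).integral_deriv_eq_sub]
    exact h1.sub (h2.comp Filter.tendsto_neg_atTop_atBot)
  rw [sub_zero] at B
  exact tendsto_nhds_unique A B

/-- Integration by parts against a smooth compactly supported function. -/
theorem integral_deriv_mul_eq_neg_of_lipschitz {f θ : ℝ → ℝ} {C : NNReal} (hf : LipschitzWith C f)
    (θs : ContDiff ℝ 1 θ) (θc : HasCompactSupport θ) :
    ∫ x, deriv f x * θ x = -∫ x, f x * deriv θ x := by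
  obtain ⟨D, hD⟩ := ContDiff.lipschitzWith_of_hasCompactSupport θc θs (by simp)
  have dθs : Continuous (deriv θ) := θs.continuous_deriv le_rfl
  have i1 : Integrable fun x => deriv f x * θ x := by
    have hli : LocallyIntegrable (deriv f) := by
      refine (locallyIntegrable_const (C : ℝ)).mono (measurable_deriv f).aestronglyMeasurable
        (Filter.Eventually.of_forall fun x => ?_)
      simpa using norm_deriv_le_of_lipschitz (x₀ := x) hf
    exact hli.integrable_smul_right_of_hasCompactSupport θs.continuous θc
  have i2 : Integrable fun x => f x * deriv θ x :=
    (hf.continuous.mul dθs).integrable_of_hasCompactSupport θc.deriv.mul_left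
  have hae : deriv (fun x => f x * θ x) =ᵐ[volume] fun x => deriv f x * θ x + f x * deriv θ x := by
    filter_upwards [hf.ae_differentiableAt] with x hx
    exact (hx.hasDerivAt.fun_mul (θs.differentiable (by simp) x).hasDerivAt).deriv
  have fc : HasCompactSupport fun x => f x * θ x := θc.mul_left
  have z := integral_deriv_eq_zero_of_tendsto (u := fun x => f x * θ x)
    (fun a b => (AbsolutelyContinuousOnInterval.of_lipschitz hf a b).fun_mul (.of_lipschitz hD a b))
    ((i1.add i2).congr hae.symm)
    (fc.is_zero_at_infty.mono_left atTop_le_cocompact)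
    (fc.is_zero_at_infty.mono_left atBot_le_cocompact)
  rw [integral_congr_ae hae, integral_add i1 i2] at z
  linarith

/-- Grönwall's inequality in integral form. -/
theorem le_mul_exp_of_le_add_integral {u : ℝ → ℝ} {u₀ c t : ℝ} (hu : Continuous u) (hc : 0 ≤ c)
    (h : ∀ s, 0 ≤ s → u s ≤ u₀ + c * ∫ r in 0..s, u r) (ht : 0 ≤ t) :
    u t ≤ u₀ * Real.exp (c * t) := by
  set v : ℝ → ℝ := fun s => u₀ + c * ∫ r in 0..s, u r with hv
  have vd : ∀ s, HasDerivAt v (c * u s) s := fun s =>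
    ((intervalIntegral.integral_hasDerivAt_right (hu.intervalIntegrable _ _)
      (hu.stronglyMeasurableAtFilter _ _) hu.continuousAt).const_mul c).const_add u₀
  have ed : ∀ s, HasDerivAt (fun s => Real.exp (-(c * s))) (Real.exp (-(c * s)) * (-c)) s :=
    fun s => by simpa using (((hasDerivAt_id s).const_mul c).neg).exp
  have wd := fun s => (ed s).mul (vd s)
  -- The derivative is `c exp(-cs) (u - v)`, and the hypothesis says `u ≤ v`.
  have anti : AntitoneOn ((fun s => Real.exp (-(c * s))) * v) (Ici 0) := by
    refine antitoneOn_of_deriv_nonpos (convex_Ici 0)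
      (fun s _ => (wd s).continuousAt.continuousWithinAt)
      (fun s _ => (wd s).differentiableAt.differentiableWithinAt) fun s hs => ?_
    rw [interior_Ici] at hs
    rw [(wd s).deriv]
    have := mul_nonneg (mul_nonneg (Real.exp_pos (-(c * s))).le hc) (sub_nonneg.2 (h s (le_of_lt hs)))
    simp only [hv]
    linarith
  have h1 := anti (mem_Ici.2 le_rfl) (mem_Ici.2 ht) ht
  simp only [Pi.mul_apply, hv, mul_zero, neg_zero, Real.exp_zero, intervalIntegral.integral_same,
    add_zero, one_mul] at h1
  rw [Real.exp_neg, inv_mul_le_iff₀ (Real.exp_pos _)] at h1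
  linarith [h t ht, mul_comm u₀ (Real.exp (c * t))]

/-! ### The exponential averaging operator -/

/-- The one-sided exponential average `(1/ε) ∫_x^∞ exp((x - y)/ε) k(y) dy`. -/
noncomputable def expAverage (ε : ℝ) (k : ℝ → ℝ) (x : ℝ) : ℝ :=
  1 / ε * ∫ y in Ioi x, Real.exp ((x - y) / ε) * k y

theorem nonlocalImpact_expKernel {ε : ℝ} (hε : 0 < ε) (ρ : ℝ → ℝ → ℝ) (t x : ℝ) :
    nonlocalImpact expKernel ε ρ t x = expAverage ε (ρ t) x := by
  unfold nonlocalImpact expAverage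
  congr 1
  refine setIntegral_congr_fun measurableSet_Ioi fun y hy => ?_
  have : (x - y) / ε ∈ Iic (0 : ℝ) :=
    div_nonpos_of_nonpos_of_nonneg (sub_nonpos.2 (le_of_lt hy)) hε.le
  simp only [expKernel, indicator_of_mem this]

/-- The kernel whose convolution gives `expAverage`. -/
noncomputable def averageKernel (ε : ℝ) : ℝ → ℝ :=
  indicator (Iic 0) fun z => 1 / ε * Real.exp (1 / ε * z)

theorem integrable_averageKernel {ε : ℝ} (hε : 0 < ε) : Integrable (averageKernel ε) := by
  unfold averageKernel
  rw [integrable_indicator_iff measurableSet_Iic]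
  exact (integrableOn_exp_mul_Iic (by positivity) 0).const_mul _

theorem integral_averageKernel {ε : ℝ} (hε : 0 < ε) : ∫ z, averageKernel ε z = 1 := by
  unfold averageKernel
  rw [integral_indicator measurableSet_Iic, integral_const_mul,
    integral_exp_mul_Iic (by positivity) 0]
  simp [hε.ne']

theorem averageKernel_nonneg {ε : ℝ} (hε : 0 < ε) (z : ℝ) : 0 ≤ averageKernel ε z :=
  indicator_nonneg (fun _ _ => by positivity) _

theorem expAverage_eq_integral (ε : ℝ) (k : ℝ → ℝ) (x : ℝ) :
    expAverage ε k x = ∫ y, k y * averageKernel ε (x - y) := by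
  unfold expAverage
  rw [← integral_const_mul, ← integral_Ici_eq_integral_Ioi, ← integral_indicator measurableSet_Ici]
  congr 1
  ext y
  by_cases hy : x ≤ y
  · rw [indicator_of_mem (mem_Ici.2 hy), averageKernel,
      indicator_of_mem (mem_Iic.2 (sub_nonpos.2 hy))]
    ring_nf
  · rw [indicator_of_notMem (by simpa using hy), averageKernel,
      indicator_of_notMem (by simpa using hy), mul_zero]

theorem expAverage_eq_convolution (ε : ℝ) (k : ℝ → ℝ) :
    expAverage ε k = convolution k (averageKernel ε) (ContinuousLinearMap.mul ℝ ℝ) volume := by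
  ext x
  rw [expAverage_eq_integral]
  rfl

theorem integrable_expAverage {ε : ℝ} (hε : 0 < ε) {k : ℝ → ℝ} (hk : Integrable k) :
    Integrable (expAverage ε k) := by
  rw [expAverage_eq_convolution]
  exact hk.integrable_convolution _ (integrable_averageKernel hε)

/-- The kernel has unit mass. This conservation is why the averaged source term does not contribute
to the growth of the `L¹` distance. -/
theorem integral_expAverage {ε : ℝ} (hε : 0 < ε) {k : ℝ → ℝ} (hk : Integrable k) :
    ∫ x, expAverage ε k x = ∫ x, k x := by
  rw [expAverage_eq_convolution, integral_convolution _ hk (integrable_averageKernel hε),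
    integral_averageKernel hε]
  simp

section Bounded

variable {ε : ℝ} {k k' : ℝ → ℝ} {M M' : ℝ}

theorem integrable_mul_averageKernel (hε : 0 < ε) (hk : AEStronglyMeasurable k volume)
    (hM : ∀ᵐ y, |k y| ≤ M) (x : ℝ) : Integrable fun y => k y * averageKernel ε (x - y) :=
  ((integrable_averageKernel hε).comp_sub_left x).bdd_mul hk hM

theorem expAverage_sub (hε : 0 < ε) (hk : AEStronglyMeasurable k volume)
    (hM : ∀ᵐ y, |k y| ≤ M) (hk' : AEStronglyMeasurable k' volume) (hM' : ∀ᵐ y, |k' y| ≤ M')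
    (x : ℝ) : expAverage ε (fun y => k y - k' y) x = expAverage ε k x - expAverage ε k' x := by
  simp only [expAverage_eq_integral, sub_mul]
  exact integral_sub (integrable_mul_averageKernel hε hk hM x)
    (integrable_mul_averageKernel hε hk' hM' x)

theorem abs_expAverage_le_expAverage_abs (hε : 0 < ε) (k : ℝ → ℝ) (x : ℝ) :
    |expAverage ε k x| ≤ expAverage ε (fun y => |k y|) x := by
  simp only [expAverage_eq_integral, ← Real.norm_eq_abs]
  refine (norm_integral_le_integral_norm _).trans (le_of_eq ?_)
  congr 1
  ext y
  rw [norm_mul, Real.norm_of_nonneg (averageKernel_nonneg hε _)]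

theorem abs_expAverage_le (hε : 0 < ε) (hM : ∀ᵐ y, |k y| ≤ M) (x : ℝ) :
    |expAverage ε k x| ≤ M := by
  rw [expAverage_eq_integral, ← Real.norm_eq_abs]
  refine (norm_integral_le_of_norm_le (g := fun y => M * averageKernel ε (x - y))
    (((integrable_averageKernel hε).comp_sub_left x).const_mul M) ?_).trans (le_of_eq ?_)
  · filter_upwards [hM] with y hy
    rw [norm_mul, Real.norm_of_nonneg (averageKernel_nonneg hε _)]
    exact mul_le_mul_of_nonneg_right hy (averageKernel_nonneg hε _)
  · rw [integral_const_mul, integral_sub_left_eq_self (averageKernel ε) volume x,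
      integral_averageKernel hε, mul_one]

theorem integrableOn_exp_neg_mul (hε : 0 < ε) (hk : AEStronglyMeasurable k volume)
    (hM : ∀ᵐ y, |k y| ≤ M) (x : ℝ) :
    IntegrableOn (fun y => Real.exp (-y / ε) * k y) (Ioi x) := by
  have h1 : IntegrableOn (fun y => Real.exp (-y / ε)) (Ioi x) := by
    refine (integrableOn_exp_mul_Ioi (a := -(1 / ε)) (by simpa using hε) x).congr_fun
      (fun y _ => ?_) measurableSet_Ioi
    ring_nf
  exact h1.mul_bdd hk.restrict (ae_restrict_of_ae hM)

/-- The kernel factorises as `exp(x/ε) exp(-y/ε)`, so all dependence on `x` sits in a smooth factor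
and the endpoint of an integral. Differentiability and the Lipschitz bound both follow from this
form. -/
theorem expAverage_eq_exp_mul (hε : 0 < ε) (hk : AEStronglyMeasurable k volume)
    (hM : ∀ᵐ y, |k y| ≤ M) (a x : ℝ) :
    expAverage ε k x = Real.exp (x / ε) *
      (Real.exp (-a / ε) * expAverage ε k a - 1 / ε * ∫ y in a..x, Real.exp (-y / ε) * k y) := by
  have h1 : ∀ x, expAverage ε k x =
      1 / ε * (Real.exp (x / ε) * ∫ y in Ioi x, Real.exp (-y / ε) * k y) := fun x => by
    unfold expAverage
    rw [← integral_const_mul (Real.exp (x / ε))]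
    congr 2
    ext y
    rw [← mul_assoc, ← Real.exp_add]
    ring_nf
  rw [h1, h1 a, ← intervalIntegral.integral_Ioi_sub_Ioi' (integrableOn_exp_neg_mul hε hk hM a)
    (integrableOn_exp_neg_mul hε hk hM x)]
  have : Real.exp (-a / ε) * Real.exp (a / ε) = 1 := by
    rw [← Real.exp_add]
    ring_nf
    simp
  linear_combination (-(Real.exp (x / ε) * (1 / ε) *
    ∫ y in Ioi a, Real.exp (-y / ε) * k y)) * this

theorem locallyIntegrable_of_ae_bdd (hk : AEStronglyMeasurable k volume)
    (hM : ∀ᵐ y, |k y| ≤ M) : LocallyIntegrable k :=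
  (locallyIntegrable_const M).mono hk (by
    filter_upwards [hM] with y hy
    rw [Real.norm_eq_abs, Real.norm_eq_abs]
    exact hy.trans (le_abs_self _))

/-- The resolvent identity `(1 - ε ∂ₓ) A k = k`, obtained from Lebesgue differentiation of the
primitive in `expAverage_eq_exp_mul`. -/
theorem ae_hasDerivAt_expAverage (hε : 0 < ε) (hk : AEStronglyMeasurable k volume)
    (hM : ∀ᵐ y, |k y| ≤ M) :
    ∀ᵐ x, HasDerivAt (expAverage ε k) ((expAverage ε k x - k x) / ε) x := by
  have hloc : LocallyIntegrable fun y => Real.exp (-y / ε) * k y :=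
    (locallyIntegrable_of_ae_bdd hk hM).continuous_mul (by fun_prop)
  filter_upwards [_root_.LocallyIntegrable.ae_hasDerivAt_integral hloc] with x hx
  have e1 := expAverage_eq_exp_mul hε hk hM 0
  have d1 : HasDerivAt (fun x => Real.exp (x / ε)) (Real.exp (x / ε) * (1 / ε)) x :=
    ((hasDerivAt_id x).div_const ε).exp
  have d2 := d1.fun_mul (((hx 0).const_mul (1 / ε)).const_sub
    (Real.exp (-0 / ε) * expAverage ε k 0))
  refine (d2.congr_of_eventuallyEq (Filter.Eventually.of_forall e1)).congr_deriv ?_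
  rw [e1 x]
  have : Real.exp (x / ε) * Real.exp (-x / ε) = 1 := by
    rw [← Real.exp_add]
    ring_nf
    simp
  linear_combination (-(k x / ε)) * this

/-- Moving `x` changes the exponential factor and the domain of integration; each effect costs `M /
ε` per unit length. The constant depends on `k` only through `M`, hence is uniform in time later on.
-/
theorem lipschitzWith_expAverage (hε : 0 < ε) (hk : AEStronglyMeasurable k volume)
    (hM : ∀ᵐ y, |k y| ≤ M) : LipschitzWith (2 * M / ε).toNNReal (expAverage ε k) := by
  have hM0 : 0 ≤ M := (abs_nonneg _).trans (abs_expAverage_le hε hM 0)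
  refine LipschitzWith.of_dist_le_mul fun x x' => ?_
  rw [Real.coe_toNNReal _ (by positivity)]
  wlog hxx : x ≤ x' generalizing x x'
  · rw [dist_comm, dist_comm x]
    exact this x' x (le_of_not_ge hxx)
  have h1 := expAverage_eq_exp_mul hε hk hM x' x
  rw [intervalIntegral.integral_symm] at h1
  set J := ∫ y in x..x', Real.exp (-y / ε) * k y with hJ
  have hx : Real.exp (x / ε) * Real.exp (-x' / ε) = Real.exp (-((x' - x) / ε)) := by
    rw [← Real.exp_add]
    ring_nf
  have hJb : |Real.exp (x / ε) * J| ≤ M * (x' - x) := by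
    rw [hJ, ← intervalIntegral.integral_const_mul]
    have : ∀ᵐ y, y ∈ uIoc x x' →
        ‖Real.exp (x / ε) * (Real.exp (-y / ε) * k y)‖ ≤ M := by
      filter_upwards [hM] with y hy hyx
      rw [uIoc_of_le hxx] at hyx
      rw [← mul_assoc, ← Real.exp_add, norm_mul, Real.norm_of_nonneg (Real.exp_pos _).le]
      have : Real.exp (x / ε + -y / ε) ≤ 1 := by
        rw [Real.exp_le_one_iff, ← add_div]
        exact div_nonpos_of_nonpos_of_nonneg (by linarith [hyx.1]) hε.le
      calc _ ≤ 1 * M := mul_le_mul this hy (abs_nonneg _) zero_le_one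
        _ = M := one_mul M
    have h2 := intervalIntegral.norm_integral_le_of_norm_le_const_ae this
    rwa [abs_of_nonneg (sub_nonneg.2 hxx)] at h2
  have hh : 0 ≤ (x' - x) / ε := div_nonneg (sub_nonneg.2 hxx) hε.le
  have he1 : 1 - (x' - x) / ε ≤ Real.exp (-((x' - x) / ε)) := by
    linarith [Real.add_one_le_exp (-((x' - x) / ε))]
  have he2 : Real.exp (-((x' - x) / ε)) ≤ 1 := Real.exp_le_one_iff.2 (by linarith)
  have h3 : expAverage ε k x - expAverage ε k x' =
      (Real.exp (-((x' - x) / ε)) - 1) * expAverage ε k x' + 1 / ε * (Real.exp (x / ε) * J) := by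
    rw [h1, ← hx]; ring
  rw [Real.dist_eq, h3, dist_comm, Real.dist_eq, abs_of_nonneg (sub_nonneg.2 hxx)]
  refine (abs_add_le _ _).trans ?_
  rw [abs_mul, abs_mul (1 / ε), abs_of_nonneg (by positivity : 0 ≤ 1 / ε)]
  have h4 : |Real.exp (-((x' - x) / ε)) - 1| * |expAverage ε k x'| ≤ (x' - x) / ε * M :=
    mul_le_mul (abs_le.2 ⟨by linarith, by linarith⟩) (abs_expAverage_le hε hM x')
      (abs_nonneg _) hh
  have h5 := mul_le_mul_of_nonneg_left hJb (by positivity : 0 ≤ 1 / ε)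
  calc _ ≤ (x' - x) / ε * M + 1 / ε * (M * (x' - x)) := add_le_add h4 h5
    _ = 2 * M / ε * (x' - x) := by ring

end Bounded

/-! ### Exponential weights -/

/-- The exponential weight. -/
noncomputable def expWeight (δ x : ℝ) : ℝ := Real.exp (-(δ * |x|))

theorem expWeight_pos (δ x : ℝ) : 0 < expWeight δ x := Real.exp_pos _

theorem expWeight_le_one {δ : ℝ} (hδ : 0 ≤ δ) (x : ℝ) : expWeight δ x ≤ 1 := by
  unfold expWeight
  rw [Real.exp_le_one_iff]
  have := mul_nonneg hδ (abs_nonneg x)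
  linarith

@[fun_prop]
theorem continuous_expWeight (δ : ℝ) : Continuous (expWeight δ) := by
  unfold expWeight
  fun_prop

theorem expWeight_le_mul {δ : ℝ} (hδ : 0 ≤ δ) (x y : ℝ) :
    expWeight δ x ≤ Real.exp (δ * |y - x|) * expWeight δ y := by
  unfold expWeight
  rw [← Real.exp_add, Real.exp_le_exp]
  have : |y| ≤ |y - x| + |x| := by
    have := abs_add_le (y - x) x
    rwa [sub_add_cancel] at this
  nlinarith [mul_le_mul_of_nonneg_left this hδ]

theorem integrable_expWeight {δ : ℝ} (hδ : 0 < δ) : Integrable (expWeight δ) := by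
  have h1 : IntegrableOn (fun x => Real.exp (-δ * x)) (Ioi 0) :=
    integrableOn_exp_mul_Ioi (by linarith) 0
  have h2 : IntegrableOn (fun x => Real.exp (δ * x)) (Iic 0) := integrableOn_exp_mul_Iic hδ 0
  rw [← integrableOn_univ, ← Iic_union_Ioi (a := (0 : ℝ))]
  refine IntegrableOn.union ?_ ?_
  · refine h2.congr_fun (fun x hx => ?_) measurableSet_Iic
    simp only [expWeight, abs_of_nonpos (mem_Iic.1 hx)]
    ring_nf
  · refine h1.congr_fun (fun x hx => ?_) measurableSet_Ioi
    simp only [expWeight, abs_of_pos (mem_Ioi.1 hx)]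
    ring_nf

theorem lipschitzWith_expWeight {δ : ℝ} (hδ : 0 ≤ δ) : LipschitzWith δ.toNNReal (expWeight δ) := by
  refine LipschitzWith.of_dist_le_mul fun x y => ?_
  rw [Real.coe_toNNReal _ hδ]
  have key : ∀ x y, expWeight δ x - expWeight δ y ≤ δ * |x - y| := fun x y => by
    have h1 := expWeight_le_mul hδ y x
    have h2 := Real.add_one_le_exp (-(δ * |x - y|))
    have h3 : expWeight δ x * Real.exp (-(δ * |x - y|)) ≤ expWeight δ y := by
      have h4 := expWeight_le_mul hδ x y
      rw [Real.exp_neg, ← div_eq_mul_inv, div_le_iff₀ (Real.exp_pos _), mul_comm, abs_sub_comm]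
      exact h4
    have h5 := mul_le_mul_of_nonneg_left h2 (expWeight_pos δ x).le
    have h6 : expWeight δ x * (δ * |x - y|) ≤ 1 * (δ * |x - y|) :=
      mul_le_mul_of_nonneg_right (expWeight_le_one hδ x) (by positivity)
    linarith
  rw [Real.dist_eq, Real.dist_eq, abs_le]
  have h := key y x
  rw [abs_sub_comm y x] at h
  exact ⟨by linarith, key x y⟩

theorem hasDerivAt_expWeight_and_abs_deriv_le {δ : ℝ} (hδ : 0 ≤ δ) {x : ℝ} (hx : x ≠ 0) :
    HasDerivAt (expWeight δ) (deriv (expWeight δ) x) x ∧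
      |deriv (expWeight δ) x| ≤ δ * expWeight δ x := by
  have h : HasDerivAt (expWeight δ) (Real.exp (-(δ * |x|)) * (-(δ * (SignType.sign x : ℝ)))) x :=
    (((hasDerivAt_abs hx).const_mul δ).fun_neg).exp
  refine ⟨h.differentiableAt.hasDerivAt, ?_⟩
  rw [h.deriv, abs_mul, abs_of_pos (Real.exp_pos _), abs_neg, abs_mul, abs_of_nonneg hδ]
  have : |((SignType.sign x : SignType) : ℝ)| ≤ 1 := by
    rcases lt_or_gt_of_ne hx with h | h <;> simp [h]
  have h2 := mul_le_mul_of_nonneg_left this hδ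
  have h3 := mul_le_mul_of_nonneg_left h2 (Real.exp_pos (-(δ * |x|))).le
  unfold expWeight
  linarith

theorem tendsto_expWeight_atTop {δ : ℝ} (hδ : 0 < δ) :
    Filter.Tendsto (expWeight δ) Filter.atTop (nhds 0) :=
  Real.tendsto_exp_neg_atTop_nhds_zero.comp
    (Filter.tendsto_abs_atTop_atTop.const_mul_atTop hδ)

theorem tendsto_expWeight_atBot {δ : ℝ} (hδ : 0 < δ) :
    Filter.Tendsto (expWeight δ) Filter.atBot (nhds 0) :=
  Real.tendsto_exp_neg_atTop_nhds_zero.comp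
    (Filter.tendsto_abs_atBot_atTop.const_mul_atTop hδ)

/-- Averaging almost preserves exponentially weighted integrals. -/
theorem integral_expWeight_mul_expAverage_le {ε δ M : ℝ} {k : ℝ → ℝ} (hε : 0 < ε) (hδ : 0 < δ)
    (hεδ : ε * δ < 1) (hk : Continuous k) (hM : ∀ y, |k y| ≤ M) (h0 : ∀ y, 0 ≤ k y) :
    ∫ x, expWeight δ x * expAverage ε k x ≤ (1 - ε * δ)⁻¹ * ∫ x, expWeight δ x * k x := by
  -- Chosen so that `1/ε' = 1/ε - δ`: the factor `exp(δ(y - x))` lost when the weight moves from `x`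
  -- to `y` is absorbed by the slower kernel. That kernel again preserves mass, and comparing
  -- normalisations leaves the constant `(1 - εδ)⁻¹`.
  set ε' := ε / (1 - ε * δ) with hε'
  have hp : 0 < 1 - ε * δ := by linarith
  have hε'0 : 0 < ε' := div_pos hε hp
  have hM' : ∀ᵐ y, |k y| ≤ M := Filter.Eventually.of_forall hM
  have hi : Integrable fun x => expWeight δ x * k x :=
    (integrable_expWeight hδ).mul_bdd hk.aestronglyMeasurable hM'
  have hA : Continuous (expAverage ε k) :=
    (lipschitzWith_expAverage hε hk.aestronglyMeasurable hM').continuous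
  rw [← integral_expAverage hε'0 hi, ← integral_const_mul]
  refine integral_mono
    ((integrable_expWeight hδ).mul_bdd hA.aestronglyMeasurable
      (Filter.Eventually.of_forall fun x => abs_expAverage_le hε hM' x))
    ((integrable_expAverage hε'0 hi).const_mul _) fun x => ?_
  dsimp only
  have hMw : ∀ᵐ y, |expWeight δ y * k y| ≤ M := by
    refine Filter.Eventually.of_forall fun y => ?_
    rw [abs_mul, abs_of_pos (expWeight_pos δ y)]
    exact (mul_le_mul_of_nonneg_right (expWeight_le_one hδ.le y) (abs_nonneg _)).trans
      (by rw [one_mul]; exact hM y)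
  rw [expAverage_eq_integral, expAverage_eq_integral, ← integral_const_mul, ← integral_const_mul]
  refine integral_mono ((integrable_mul_averageKernel hε hk.aestronglyMeasurable hM' x).const_mul _)
    ((integrable_mul_averageKernel hε'0 (by fun_prop) hMw x).const_mul _) fun y => ?_
  dsimp only
  unfold averageKernel
  by_cases hxy : x - y ∈ Iic (0 : ℝ)
  · rw [indicator_of_mem hxy, indicator_of_mem hxy]
    have h1 := expWeight_le_mul hδ.le x y
    have hyx : |y - x| = y - x := abs_of_nonneg (by have := mem_Iic.1 hxy; linarith)
    rw [hyx] at h1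
    have e1 : (1 - ε * δ)⁻¹ * (1 / ε') = 1 / ε := by
      rw [hε']; field_simp
    have e2 : Real.exp (1 / ε' * (x - y)) =
        Real.exp (δ * (y - x)) * Real.exp (1 / ε * (x - y)) := by
      rw [← Real.exp_add, hε']
      congr 1
      field_simp
      ring
    rw [e2]
    calc expWeight δ x * (k y * (1 / ε * Real.exp (1 / ε * (x - y))))
        ≤ (Real.exp (δ * (y - x)) * expWeight δ y) *
          (k y * (1 / ε * Real.exp (1 / ε * (x - y)))) :=
          mul_le_mul_of_nonneg_right h1 (mul_nonneg (h0 y) (by positivity))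
      _ = _ := by rw [← e1]; ring
  · rw [indicator_of_notMem hxy, indicator_of_notMem hxy]
    simp

/-! ### The velocity primitive and the relaxation nonlinearity -/

/-- The primitive of the velocity. -/
noncomputable def velocityPrimitive (V : ℝ → ℝ) (w : ℝ) : ℝ := ∫ s in 0..w, V s

/-- The nonlinearity `V(w) w - ∫₀ʷ V` of the relaxation term in the equation for the impact. -/
noncomputable def relaxation (V : ℝ → ℝ) (w : ℝ) : ℝ := V w * w - velocityPrimitive V w

/-- The flux in the conservation law satisfied by the nonlocal impact. -/
noncomputable def impactFlux (V : ℝ → ℝ) (ε : ℝ) (u : ℝ → ℝ) (x : ℝ) : ℝ :=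
  velocityPrimitive V (u x) + expAverage ε (fun y => relaxation V (u y)) x

section Velocity

variable {V : ℝ → ℝ} {K : NNReal} {L : ℝ}

theorem velocityPrimitive_sub (hV : Continuous V) (a b : ℝ) :
    velocityPrimitive V a - velocityPrimitive V b = ∫ s in b..a, V s :=
  intervalIntegral.integral_interval_sub_left (hV.intervalIntegrable _ _)
    (hV.intervalIntegrable _ _)

theorem hasDerivAt_velocityPrimitive (hV : Continuous V) (w : ℝ) :
    HasDerivAt (velocityPrimitive V) (V w) w :=
  intervalIntegral.integral_hasDerivAt_right (hV.intervalIntegrable _ _)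
    (hV.stronglyMeasurableAtFilter _ _) hV.continuousAt

theorem continuous_velocityPrimitive (hV : Continuous V) : Continuous (velocityPrimitive V) :=
  continuous_iff_continuousAt.2 fun w => (hasDerivAt_velocityPrimitive hV w).continuousAt

theorem continuous_relaxation (hV : Continuous V) : Continuous (relaxation V) :=
  (hV.mul continuous_id).sub (continuous_velocityPrimitive hV)

theorem abs_velocityPrimitive_sub_le (hV : Continuous V) (hL : ∀ x, |V x| ≤ L) (a b : ℝ) :
    |velocityPrimitive V a - velocityPrimitive V b| ≤ L * |a - b| := by
  rw [velocityPrimitive_sub hV]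
  exact intervalIntegral.norm_integral_le_of_norm_le_const (f := V) fun s _ => hL s

theorem lipschitzWith_velocityPrimitive (hV : Continuous V) (hL : ∀ x, |V x| ≤ L) :
    LipschitzWith L.toNNReal (velocityPrimitive V) :=
  LipschitzWith.of_dist_le_mul fun a b => by
    rw [Real.coe_toNNReal _ ((abs_nonneg _).trans (hL 0))]
    exact abs_velocityPrimitive_sub_le hV hL a b

theorem abs_relaxation_le (hV : Continuous V) (hL : ∀ x, |V x| ≤ L) {w : ℝ}
    (hw : w ∈ Icc (0 : ℝ) 1) : |relaxation V w| ≤ 2 * L := by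
  have h1 := abs_velocityPrimitive_sub_le hV hL w 0
  have h0 : velocityPrimitive V 0 = 0 := by simp [velocityPrimitive]
  have hw' : |w| ≤ 1 := by rw [abs_of_nonneg hw.1]; exact hw.2
  have hL0 : 0 ≤ L := (abs_nonneg _).trans (hL 0)
  rw [h0, sub_zero, sub_zero] at h1
  have h2 : |V w * w| ≤ L * 1 := by
    rw [abs_mul]
    exact mul_le_mul (hL w) hw' (abs_nonneg _) hL0
  have h3 := mul_le_mul_of_nonneg_left hw' hL0
  unfold relaxation
  exact (abs_sub _ _).trans (by linarith)

/-- A substitute for `R'(w) = V'(w) w` that needs no derivative of `V`: both terms on the right have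
a visible sign when `V` is monotone, and a visible size when `V` is Lipschitz. -/
theorem relaxation_sub (hV : Continuous V) (a b : ℝ) :
    relaxation V a - relaxation V b = (V a - V b) * b + ∫ s in b..a, (V a - V s) := by
  rw [intervalIntegral.integral_sub (by simp) (hV.intervalIntegrable _ _),
    ← velocityPrimitive_sub hV, intervalIntegral.integral_const, smul_eq_mul]
  unfold relaxation
  ring

theorem relaxation_antitoneOn (hV : Continuous V) (ha : Antitone V) :
    AntitoneOn (relaxation V) (Ici 0) := by
  intro b hb a _ hba
  have h := relaxation_sub hV a b
  have h1 : (V a - V b) * b ≤ 0 := mul_nonpos_of_nonpos_of_nonneg (sub_nonpos.2 (ha hba)) hb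
  have h2 : ∫ s in b..a, (V a - V s) ≤ ∫ s in b..a, (0 : ℝ) :=
    intervalIntegral.integral_mono_on hba (Continuous.intervalIntegrable (by fun_prop) _ _) (by simp)
      fun s hs => sub_nonpos.2 (ha hs.2)
  rw [intervalIntegral.integral_zero] at h2
  linarith

/-- On the unit interval `b ≤ 1` and `|V a - V s| ≤ K`, so each of the two terms of `relaxation_sub`
contributes `K |a - b|`. -/
theorem abs_relaxation_sub_le (hV : LipschitzWith K V) {a b : ℝ} (ha : a ∈ Icc (0 : ℝ) 1)
    (hb : b ∈ Icc (0 : ℝ) 1) : |relaxation V a - relaxation V b| ≤ 2 * K * |a - b| := by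
  rw [relaxation_sub hV.continuous]
  have h1 : |V a - V b| ≤ K * |a - b| := hV.dist_le_mul a b
  have h2 : |(V a - V b) * b| ≤ K * |a - b| * 1 := by
    rw [abs_mul, abs_of_nonneg hb.1]
    exact mul_le_mul h1 hb.2 hb.1 ((abs_nonneg _).trans h1)
  have h3 : |∫ s in b..a, (V a - V s)| ≤ K * |a - b| := by
    refine intervalIntegral.norm_integral_le_of_norm_le_const (f := fun s => V a - V s) fun s hs => ?_
    have hs1 : s ∈ Icc (0 : ℝ) 1 := (uIcc_subset_Icc hb ha) (uIoc_subset_uIcc hs)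
    refine (hV.dist_le_mul a s).trans (mul_le_of_le_one_right K.2 ?_)
    rw [Real.dist_eq, abs_le]
    exact ⟨by linarith [ha.1, hs1.2], by linarith [ha.2, hs1.1]⟩
  exact (abs_add_le _ _).trans (by linarith)

end Velocity

/-! ### The dissipation inequality at a fixed time -/

section Slice

variable {V : ℝ → ℝ} {K C : NNReal} {L ε : ℝ} {u v : ℝ → ℝ}

theorem lipschitzWith_impactFlux (hε : 0 < ε) (hV : Continuous V) (hL : ∀ x, |V x| ≤ L)
    (hu : LipschitzWith C u) (hu1 : ∀ x, u x ∈ Icc (0 : ℝ) 1) :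
    LipschitzWith (L.toNNReal * C + (2 * (2 * L) / ε).toNNReal) (impactFlux V ε u) :=
  ((lipschitzWith_velocityPrimitive hV hL).comp hu).add
    (lipschitzWith_expAverage hε
      ((continuous_relaxation hV).comp hu.continuous).aestronglyMeasurable
      (Filter.Eventually.of_forall fun y => abs_relaxation_le hV hL (hu1 y)))

theorem ae_hasDerivAt_impactFlux (hε : 0 < ε) (hV : Continuous V) (hL : ∀ x, |V x| ≤ L)
    (hu : LipschitzWith C u) (hu1 : ∀ x, u x ∈ Icc (0 : ℝ) 1) :
    ∀ᵐ x, HasDerivAt u (deriv u x) x ∧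
      HasDerivAt (impactFlux V ε u) (V (u x) * deriv u x +
        (expAverage ε (fun y => relaxation V (u y)) x - relaxation V (u x)) / ε) x := by
  filter_upwards [hu.ae_differentiableAt, ae_hasDerivAt_expAverage hε
      ((continuous_relaxation hV).comp hu.continuous).aestronglyMeasurable
      (Filter.Eventually.of_forall fun y => abs_relaxation_le hV hL (hu1 y))] with x h1 h2
  exact ⟨h1.hasDerivAt, ((hasDerivAt_velocityPrimitive hV (u x)).comp x h1.hasDerivAt).add h2⟩

/-- Domination of the entropy flux by `|u - v|` serves twice: it makes the flux flat at contact
points of `u` and `v`, and it bounds the term in which the weight is differentiated. -/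
theorem abs_velocityPrimitive_max_sub_min_le (hV : Continuous V) (hL : ∀ x, |V x| ≤ L) (a b : ℝ) :
    |velocityPrimitive V (max a b) - velocityPrimitive V (min a b)| ≤ L * |a - b| := by
  refine (abs_velocityPrimitive_sub_le hV hL _ _).trans (le_of_eq ?_)
  rw [max_sub_min_eq_abs, abs_abs, abs_sub_comm]

/-- Almost everywhere, the Kružkov entropy flux has the expected derivative. -/
theorem ae_hasDerivAt_entropyFlux (hV : Continuous V) (hL : ∀ x, |V x| ≤ L)
    (hu : LipschitzWith C u) (hv : LipschitzWith C v) :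
    ∀ᵐ x, HasDerivAt (fun y => velocityPrimitive V (max (u y) (v y)) -
        velocityPrimitive V (min (u y) (v y)))
      (Real.sign (u x - v x) * (V (u x) * deriv u x - V (v x) * deriv v x)) x := by
  have hD : LipschitzWith (C + C) (fun y => u y - v y) := hu.sub hv
  have haD : LipschitzWith (1 * (C + C)) (fun y => |u y - v y|) := lipschitzWith_one_norm.comp hD
  filter_upwards [hu.ae_differentiableAt, hv.ae_differentiableAt, haD.ae_differentiableAt]
    with x hux hvx hax
  have du := (hasDerivAt_velocityPrimitive hV (u x)).comp x hux.hasDerivAt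
  have dv := (hasDerivAt_velocityPrimitive hV (v x)).comp x hvx.hasDerivAt
  have hc : ContinuousAt (fun y => u y - v y) x := hD.continuous.continuousAt
  rcases lt_trichotomy (u x - v x) 0 with h | h | h
  · rw [Real.sign_of_neg h]
    refine ((dv.sub du).congr_of_eventuallyEq ?_).congr_deriv (by ring)
    filter_upwards [hc.eventually_lt continuousAt_const h] with y hy
    rw [max_eq_right (by linarith), min_eq_left (by linarith)]
    rfl
  -- At a contact point where `|u - v|` is differentiable, its derivative is zero by minimality, so
  -- `|u - v|` is little-o of the displacement; the entropy flux, being `O(|u - v|)`, inherits this.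
  · rw [h, Real.sign_zero, zero_mul]
    have d0 : HasDerivAt (fun y => |u y - v y|) 0 x := by
      have := hax.hasDerivAt
      rwa [IsLocalMin.deriv_eq_zero (Filter.Eventually.of_forall fun y => by simp [h])] at this
    rw [hasDerivAt_iff_isLittleO] at d0 ⊢
    refine Asymptotics.IsBigO.trans_isLittleO (Asymptotics.IsBigO.of_bound L
      (Filter.Eventually.of_forall fun y => ?_)) d0
    have huv : u x = v x := by linarith
    simpa [h, huv] using abs_velocityPrimitive_max_sub_min_le hV hL (u y) (v y)
  · rw [Real.sign_of_pos h, one_mul]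
    refine (du.sub dv).congr_of_eventuallyEq ?_
    filter_upwards [continuousAt_const.eventually_lt hc h] with y hy
    rw [max_eq_left (by linarith), min_eq_right (by linarith)]
    rfl

/-- The dissipation inequality, at a fixed time, for the difference of two impacts. -/
theorem integral_sign_mul_deriv_impactFlux_le (hε : 0 < ε) (hV : LipschitzWith K V)
    (ha : Antitone V) (hL : ∀ x, |V x| ≤ L) (hu : LipschitzWith C u) (hv : LipschitzWith C v)
    (hu1 : ∀ x, u x ∈ Icc (0 : ℝ) 1) (hv1 : ∀ x, v x ∈ Icc (0 : ℝ) 1) {δ : ℝ} (hδ : 0 < δ)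
    (hεδ : 2 * (ε * δ) ≤ 1) :
    ∫ x, expWeight δ x * (Real.sign (u x - v x) *
        -(deriv (impactFlux V ε u) x - deriv (impactFlux V ε v) x)) ≤
      (L + 4 * K) * δ * ∫ x, expWeight δ x * |u x - v x| := by
  have hVc := hV.continuous
  have hL0 : 0 ≤ L := (abs_nonneg _).trans (hL 0)
  set ψ := expWeight δ with hψ
  set k : ℝ → ℝ := fun y => relaxation V (u y) - relaxation V (v y) with hk
  set Q : ℝ → ℝ := fun y => velocityPrimitive V (max (u y) (v y)) -
        velocityPrimitive V (min (u y) (v y)) with hQ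
  have hRu : Continuous fun y => relaxation V (u y) := (continuous_relaxation hVc).comp hu.continuous
  have hRv : Continuous fun y => relaxation V (v y) := (continuous_relaxation hVc).comp hv.continuous
  have kc : Continuous k := hRu.sub hRv
  have hRub : ∀ y, |relaxation V (u y)| ≤ 2 * L := fun y => abs_relaxation_le hVc hL (hu1 y)
  have hRvb : ∀ y, |relaxation V (v y)| ≤ 2 * L := fun y => abs_relaxation_le hVc hL (hv1 y)
  have kb : ∀ y, |k y| ≤ 4 * L := fun y => (abs_sub _ _).trans (by linarith [hRub y, hRvb y])
  have akc : Continuous fun y => |k y| := kc.abs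
  have akb : ∀ y, |(|k y|)| ≤ 4 * L := fun y => by rw [abs_abs]; exact kb y
  have hψi := integrable_expWeight hδ
  have hQlip : LipschitzWith (L.toNNReal * max C C + L.toNNReal * max C C) Q :=
    ((lipschitzWith_velocityPrimitive hVc hL).comp (hu.max hv)).sub
      ((lipschitzWith_velocityPrimitive hVc hL).comp (hu.min hv))
  have hD1 : ∀ y, |u y - v y| ≤ 1 := fun y =>
    abs_le.2 ⟨by linarith [(hu1 y).1, (hv1 y).2], by linarith [(hu1 y).2, (hv1 y).1]⟩
  have hQD : ∀ y, |Q y| ≤ L * |u y - v y| := fun y =>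
    abs_velocityPrimitive_max_sub_min_le hVc hL (u y) (v y)
  have hQb : ∀ y, |Q y| ≤ L := fun y =>
    (hQD y).trans (mul_le_of_le_one_right hL0 (hD1 y))
  have hne : ∀ᵐ x : ℝ, x ≠ 0 := by simp [ae_iff]
  -- the derivative of the weighted entropy flux
  have hder : ∀ᵐ x, HasDerivAt (fun y => ψ y * Q y) (deriv ψ x * Q x + ψ x * deriv Q x) x := by
    filter_upwards [hne, hQlip.ae_differentiableAt] with x hx hq
    exact (hasDerivAt_expWeight_and_abs_deriv_le hδ.le hx).1.fun_mul hq.hasDerivAt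
  have hdQb : ∀ x, |deriv Q x| ≤ (L.toNNReal * max C C + L.toNNReal * max C C : NNReal) :=
    fun x => norm_deriv_le_of_lipschitz hQlip
  have i1 : Integrable fun x => deriv ψ x * Q x := by
    refine (hψi.const_mul (δ * L)).mono'
      ((measurable_deriv ψ).aestronglyMeasurable.mul hQlip.continuous.aestronglyMeasurable) ?_
    filter_upwards [hne] with x hx
    rw [norm_mul]
    calc _ ≤ δ * ψ x * L := mul_le_mul (hasDerivAt_expWeight_and_abs_deriv_le hδ.le hx).2 (hQb x)
          (abs_nonneg _)
          (mul_nonneg hδ.le (expWeight_pos δ x).le)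
      _ = _ := by ring
  have i2 : Integrable fun x => ψ x * deriv Q x :=
    hψi.mul_bdd (measurable_deriv Q).aestronglyMeasurable (Filter.Eventually.of_forall hdQb)
  have i3 : Integrable (deriv fun y => ψ y * Q y) := (i1.add i2).congr (by
    filter_upwards [hder] with x hx using hx.deriv.symm)
  have hlim : ∀ l : Filter ℝ, Filter.Tendsto ψ l (nhds 0) →
      Filter.Tendsto (fun y => ψ y * Q y) l (nhds 0) := fun l hl => by
    refine squeeze_zero_norm (a := fun y => ψ y * L) (fun y => ?_) (by simpa using hl.mul_const L)
    rw [norm_mul, Real.norm_of_nonneg (expWeight_pos δ y).le]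
    exact mul_le_mul_of_nonneg_left (hQb y) (expWeight_pos δ y).le
  have hzero : ∫ x, deriv (fun y => ψ y * Q y) x = 0 :=
    integral_deriv_eq_zero_of_tendsto (fun a b =>
      (AbsolutelyContinuousOnInterval.of_lipschitz (lipschitzWith_expWeight hδ.le) a b).fun_mul
        (.of_lipschitz hQlip a b)) i3 (hlim _ (tendsto_expWeight_atTop hδ))
      (hlim _ (tendsto_expWeight_atBot hδ))
  have hAc : Continuous (expAverage ε fun y => |k y|) :=
    (lipschitzWith_expAverage hε akc.aestronglyMeasurable
      (Filter.Eventually.of_forall akb)).continuous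
  have i4 : Integrable fun x => ψ x * expAverage ε (fun y => |k y|) x :=
    hψi.mul_bdd hAc.aestronglyMeasurable (Filter.Eventually.of_forall fun x =>
      abs_expAverage_le hε (Filter.Eventually.of_forall akb) x)
  have i5 : Integrable fun x => ψ x * |k x| :=
    hψi.mul_bdd akc.aestronglyMeasurable (Filter.Eventually.of_forall akb)
  have i6 : Integrable fun x => ψ x * |u x - v x| :=
    hψi.mul_bdd (hu.continuous.sub hv.continuous).abs.aestronglyMeasurable
      (Filter.Eventually.of_forall fun x => by
        rw [Real.norm_eq_abs, abs_abs]; exact hD1 x)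
  -- The product rule on `ψ Q` isolates an exact derivative of zero integral; what remains is the
  -- derivative of the weight and the relaxation source.
  have hp : ∀ᵐ x, ψ x * (Real.sign (u x - v x) *
        -(deriv (impactFlux V ε u) x - deriv (impactFlux V ε v) x)) ≤
      δ * L * (ψ x * |u x - v x|) - deriv (fun y => ψ y * Q y) x +
        1 / ε * (ψ x * expAverage ε (fun y => |k y|) x - ψ x * |k x|) := by
    filter_upwards [hne, hder, ae_hasDerivAt_entropyFlux hVc hL hu hv,
      ae_hasDerivAt_impactFlux hε hVc hL hu hu1, ae_hasDerivAt_impactFlux hε hVc hL hv hv1]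
      with x hx h1 h2 h3 h4
    rw [h1.deriv, h3.2.deriv, h4.2.deriv, h2.deriv]
    have hψ0 : 0 ≤ ψ x := (expWeight_pos δ x).le
    have hAk := expAverage_sub hε hRu.aestronglyMeasurable (Filter.Eventually.of_forall hRub)
      hRv.aestronglyMeasurable (Filter.Eventually.of_forall hRvb) x
    -- Monotonicity of `V` enters here: `R` is nonincreasing on `[0, ∞)`, so `k` has the sign
    -- opposite to `u - v`.
    have hs : Real.sign (u x - v x) * k x = -|k x| := by
      rcases lt_trichotomy (u x - v x) 0 with h | h | h
      · rw [Real.sign_of_neg h, abs_of_nonneg]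
        · ring
        · exact sub_nonneg.2 (relaxation_antitoneOn hVc ha (hu1 x).1 (hv1 x).1 (by linarith))
      · have : u x = v x := by linarith
        simp [hk, this]
      · rw [Real.sign_of_pos h, abs_of_nonpos]
        · ring
        · exact sub_nonpos.2 (relaxation_antitoneOn hVc ha (hv1 x).1 (hu1 x).1 (by linarith))
    have hsA : -(Real.sign (u x - v x) * expAverage ε k x) ≤ expAverage ε (fun y => |k y|) x := by
      refine (neg_le_abs _).trans ?_
      rw [abs_mul]
      exact (mul_le_of_le_one_left (abs_nonneg _) (Real.abs_sign_le _)).trans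
        (abs_expAverage_le_expAverage_abs hε k x)
    have hψQ : deriv ψ x * Q x ≤ δ * L * (ψ x * |u x - v x|) := by
      refine (le_abs_self _).trans ?_
      rw [abs_mul]
      calc _ ≤ δ * ψ x * (L * |u x - v x|) :=
            mul_le_mul (hasDerivAt_expWeight_and_abs_deriv_le hδ.le hx).2 (hQD x)
            (abs_nonneg _) (mul_nonneg hδ.le hψ0)
        _ = _ := by ring
    have hmul : ψ x * (1 / ε) * (-(Real.sign (u x - v x) * expAverage ε k x)) ≤
        ψ x * (1 / ε) * expAverage ε (fun y => |k y|) x :=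
      mul_le_mul_of_nonneg_left hsA (by positivity)
    have hAk' : expAverage ε k x = expAverage ε (fun y => relaxation V (u y)) x -
        expAverage ε (fun y => relaxation V (v y)) x := hAk
    rw [hAk'] at hmul
    have hk' : k x = relaxation V (u x) - relaxation V (v x) := rfl
    have hs' : ψ x * (1 / ε) * (Real.sign (u x - v x) * k x) = ψ x * (1 / ε) * -|k x| := by rw [hs]
    rw [hk'] at hs'
    rw [hk']
    simp only [div_eq_mul_inv, one_mul] at hs' hmul ⊢
    linarith
  have hint : Integrable fun x => ψ x * (Real.sign (u x - v x) *
        -(deriv (impactFlux V ε u) x - deriv (impactFlux V ε v) x)) := by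
    refine hψi.mul_bdd (c := 2 * (L.toNNReal * C + (2 * (2 * L) / ε).toNNReal : NNReal)) ?_
      (Filter.Eventually.of_forall fun x => ?_)
    · exact ((Real.measurable_sign'.comp (hu.continuous.sub hv.continuous).measurable).mul
        ((measurable_deriv _).sub (measurable_deriv _)).neg).aestronglyMeasurable
    · rw [norm_mul, norm_neg]
      have h1 := norm_deriv_le_of_lipschitz (x₀ := x) (lipschitzWith_impactFlux hε hVc hL hu hu1)
      have h2 := norm_deriv_le_of_lipschitz (x₀ := x) (lipschitzWith_impactFlux hε hVc hL hv hv1)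
      exact (mul_le_of_le_one_left (norm_nonneg _) (Real.abs_sign_le _)).trans
        ((norm_sub_le _ _).trans (by linarith))
  refine (integral_mono_ae hint (((i6.const_mul (δ * L)).sub i3).add
    ((i4.sub i5).const_mul (1 / ε))) hp).trans ?_
  have hsplit : ∫ x, (δ * L * (ψ x * |u x - v x|) - deriv (fun y => ψ y * Q y) x +
        1 / ε * (ψ x * expAverage ε (fun y => |k y|) x - ψ x * |k x|)) =
      δ * L * (∫ x, ψ x * |u x - v x|) +
        1 / ε * ((∫ x, ψ x * expAverage ε (fun y => |k y|) x) - ∫ x, ψ x * |k x|) := by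
    have j1 : Integrable fun x => δ * L * (ψ x * |u x - v x|) - deriv (fun y => ψ y * Q y) x :=
      (i6.const_mul (δ * L)).sub i3
    have j2 : Integrable fun x =>
        1 / ε * (ψ x * expAverage ε (fun y => |k y|) x - ψ x * |k x|) :=
      (i4.sub i5).const_mul (1 / ε)
    rw [integral_add j1 j2, integral_sub (i6.const_mul (δ * L)) i3, hzero, integral_const_mul, integral_const_mul,
      integral_sub i4 i5, sub_zero]
  refine (le_of_eq hsplit).trans ?_
  have hA := integral_expWeight_mul_expAverage_le hε hδ (by linarith) akc akb fun y => abs_nonneg _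
  have hkD : ∫ x, ψ x * |k x| ≤ 2 * K * ∫ x, ψ x * |u x - v x| := by
    rw [← integral_const_mul]
    refine integral_mono i5 (i6.const_mul _) fun x => ?_
    have := mul_le_mul_of_nonneg_left (abs_relaxation_sub_le hV (hu1 x) (hv1 x))
      (expWeight_pos δ x).le
    dsimp only
    linarith
  have hk0 : 0 ≤ ∫ x, ψ x * |k x| :=
    integral_nonneg fun x => mul_nonneg (expWeight_pos δ x).le (abs_nonneg _)
  -- With `s = εδ ≤ 1/2`, `(1 + 2s)(1 - s) = 1 + s(1 - 2s) ≥ 1`.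
  have hinv : (1 - ε * δ)⁻¹ ≤ 1 + 2 * (ε * δ) := by
    have hεδ0 : 0 < ε * δ := mul_pos hε hδ
    rw [inv_le_iff_one_le_mul₀ (by linarith)]
    nlinarith
  have h1 : (∫ x, ψ x * expAverage ε (fun y => |k y|) x) - ∫ x, ψ x * |k x| ≤
      2 * (ε * δ) * (2 * K * ∫ x, ψ x * |u x - v x|) := by
    have h2 := mul_le_mul_of_nonneg_right hinv hk0
    have h3 := mul_le_mul_of_nonneg_left hkD (by positivity : 0 ≤ 2 * (ε * δ))
    linarith
  have h4 := mul_le_mul_of_nonneg_left h1 (by positivity : 0 ≤ 1 / ε)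
  -- The mass defect of order `εδ` cancels the singular factor `1/ε`, leaving `4Kδ`; the derivative
  -- of the weight supplies the remaining `Lδ`.
  have h5 : 1 / ε * (2 * (ε * δ) * (2 * K * ∫ x, ψ x * |u x - v x|)) =
      4 * K * δ * ∫ x, ψ x * |u x - v x| := by
    field_simp
    ring
  rw [h5] at h4
  linarith

end Slice

/-! ### Contraction for the equation satisfied by the impact -/

/-- `w` is a jointly continuous, spatially Lipschitz, `[0, 1]`-valued solution of
`∂ₜ w + ∂ₓ (impactFlux V ε w) = 0`, almost everywhere in space and integrated in time. -/
structure IsImpactSolution (V : ℝ → ℝ) (ε : ℝ) (w : ℝ → ℝ → ℝ) : Prop where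
  continuous : Continuous (Function.uncurry w)
  lipschitz : ∃ C, ∀ t, LipschitzWith C (w t)
  mem_Icc : ∀ t x, w t x ∈ Icc (0 : ℝ) 1
  evolution : ∀ᵐ x, ∀ t, 0 ≤ t → w t x = w 0 x - ∫ s in 0..t, deriv (impactFlux V ε (w s)) x

section

variable {V : ℝ → ℝ} {K : NNReal} {L ε : ℝ} {w v : ℝ → ℝ → ℝ}

/-- Joint continuity makes the spatial derivative of the flux jointly measurable in time and space,
which Fubini's theorem requires. It combines dominated convergence in time with a Lipschitz bound in
space uniform in time. -/
theorem continuous_impactFlux (hε : 0 < ε) (hV : Continuous V) (hL : ∀ x, |V x| ≤ L)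
    (hw : Continuous (Function.uncurry w)) (hw1 : ∀ t x, w t x ∈ Icc (0 : ℝ) 1) :
    Continuous (Function.uncurry fun s => impactFlux V ε (w s)) := by
  have hR : Continuous fun p : ℝ × ℝ => relaxation V (w p.1 p.2) :=
    (continuous_relaxation hV).comp hw
  have hA : Continuous fun p : ℝ × ℝ => expAverage ε (fun y => relaxation V (w p.2 y)) p.1 := by
    refine continuous_prod_of_continuous_lipschitzWith _ (2 * (2 * L) / ε).toNNReal (fun x => ?_)
      fun s => ?_
    · simp only [expAverage_eq_integral]
      refine continuous_of_dominated (bound := fun y => 2 * L * averageKernel ε (x - y))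
        (fun s => ?_) (fun s => ?_) ?_ ?_
      · exact (integrable_mul_averageKernel hε
          (hR.comp (by fun_prop : Continuous fun y => (s, y))).aestronglyMeasurable
          (Filter.Eventually.of_forall fun y => abs_relaxation_le hV hL (hw1 s y))
          x).aestronglyMeasurable
      · refine Filter.Eventually.of_forall fun y => ?_
        rw [norm_mul, Real.norm_of_nonneg (averageKernel_nonneg hε _)]
        exact mul_le_mul_of_nonneg_right (abs_relaxation_le hV hL (hw1 s y))
          (averageKernel_nonneg hε _)
      · exact ((integrable_averageKernel hε).comp_sub_left x).const_mul _
      · exact Filter.Eventually.of_forall fun y =>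
          (hR.comp (by fun_prop : Continuous fun s => (s, y))).mul continuous_const
    · exact lipschitzWith_expAverage hε
        (hR.comp (by fun_prop : Continuous fun y => (s, y))).aestronglyMeasurable
        (Filter.Eventually.of_forall fun y => abs_relaxation_le hV hL (hw1 s y))
  exact ((continuous_velocityPrimitive hV).comp hw).add (hA.comp continuous_swap)

/-- The weighted contraction estimate. -/
theorem IsImpactSolution.integral_expWeight_mul_abs_sub_le (hw : IsImpactSolution V ε w)
    (hv : IsImpactSolution V ε v) (hε : 0 < ε) (hV : LipschitzWith K V) (ha : Antitone V)
    (hL : ∀ x, |V x| ≤ L) {δ t : ℝ} (hδ : 0 < δ) (hεδ : 2 * (ε * δ) ≤ 1) (ht : 0 ≤ t) :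
    ∫ x, expWeight δ x * |w t x - v t x| ≤
      (∫ x, expWeight δ x * |w 0 x - v 0 x|) * Real.exp ((L + 4 * K) * δ * t) := by
  obtain ⟨Cw, hCw⟩ := hw.lipschitz
  obtain ⟨Cv, hCv⟩ := hv.lipschitz
  set C := max Cw Cv
  replace hCw : ∀ t, LipschitzWith C (w t) := fun t => (hCw t).weaken (le_max_left _ _)
  replace hCv : ∀ t, LipschitzWith C (v t) := fun t => (hCv t).weaken (le_max_right _ _)
  have hVc := hV.continuous
  have hL0 : 0 ≤ L := (abs_nonneg _).trans (hL 0)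
  have hψi := integrable_expWeight hδ
  have hwc : Continuous fun p : ℝ × ℝ => w p.1 p.2 := hw.continuous
  have hvc : Continuous fun p : ℝ × ℝ => v p.1 p.2 := hv.continuous
  set h : ℝ → ℝ → ℝ := fun s x =>
    -(deriv (impactFlux V ε (w s)) x - deriv (impactFlux V ε (v s)) x) with hh
  set c : NNReal := L.toNNReal * C + (2 * (2 * L) / ε).toNNReal with hc
  have hwm : Measurable fun p : ℝ × ℝ => deriv (impactFlux V ε (w p.1)) p.2 :=
    measurable_deriv_with_param (continuous_impactFlux hε hVc hL hw.continuous hw.mem_Icc)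
  have hvm : Measurable fun p : ℝ × ℝ => deriv (impactFlux V ε (v p.1)) p.2 :=
    measurable_deriv_with_param (continuous_impactFlux hε hVc hL hv.continuous hv.mem_Icc)
  have hwb : ∀ s x, |deriv (impactFlux V ε (w s)) x| ≤ c := fun s x =>
    norm_deriv_le_of_lipschitz (lipschitzWith_impactFlux hε hVc hL (hCw s) (hw.mem_Icc s))
  have hvb : ∀ s x, |deriv (impactFlux V ε (v s)) x| ≤ c := fun s x =>
    norm_deriv_le_of_lipschitz (lipschitzWith_impactFlux hε hVc hL (hCv s) (hv.mem_Icc s))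
  have hm : Measurable fun p : ℝ × ℝ => h p.1 p.2 := (hwm.sub hvm).neg
  have hb : ∀ s x, |h s x| ≤ 2 * c := fun s x => by
    rw [hh]
    dsimp only
    rw [abs_neg]
    exact (abs_sub _ _).trans (by linarith [hwb s x, hvb s x])
  have hii : ∀ f : ℝ → ℝ, Measurable f → (∀ s, |f s| ≤ c) → ∀ a b,
      IntervalIntegrable f volume a b := fun f hf hfb a b =>
    (intervalIntegrable_const (c := (c : ℝ))).mono_fun hf.aestronglyMeasurable
      (Filter.Eventually.of_forall fun s => by simpa using hfb s)
  have hwx : ∀ x, Measurable fun s => deriv (impactFlux V ε (w s)) x := fun x =>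
    hwm.comp (g := fun p : ℝ × ℝ => deriv (impactFlux V ε (w p.1)) p.2)
      (f := fun s => (s, x)) (measurable_id.prodMk measurable_const)
  have hvx : ∀ x, Measurable fun s => deriv (impactFlux V ε (v s)) x := fun x =>
    hvm.comp (g := fun p : ℝ × ℝ => deriv (impactFlux V ε (v p.1)) p.2)
      (f := fun s => (s, x)) (measurable_id.prodMk measurable_const)
  have hhx : ∀ x, Measurable fun s => h s x := fun x => ((hwx x).sub (hvx x)).neg
  have hpt : ∀ᵐ x, ∀ t, 0 ≤ t → |w t x - v t x| =
      |w 0 x - v 0 x| + ∫ s in 0..t, Real.sign (w s x - v s x) * h s x := by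
    filter_upwards [hw.evolution, hv.evolution] with x h1 h2 t ht
    refine abs_eq_abs_add_integral_sign_mul (d := fun s => w s x - v s x) (h := fun s => h s x)
      (C := 2 * c) ht (hhx x) (fun s => hb s x)
      fun s hs => ?_
    rw [h1 s hs, h2 s hs, hh]
    dsimp only
    rw [intervalIntegral.integral_neg, intervalIntegral.integral_sub]
    · ring
    · exact hii _ (hwx x) (fun s => hwb s x) _ _
    · exact hii _ (hvx x) (fun s => hvb s x) _ _
  set u : ℝ → ℝ := fun t => ∫ x, expWeight δ x * |w t x - v t x| with hu
  have hD1 : ∀ s y, |w s y - v s y| ≤ 1 := fun s y =>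
    abs_le.2 ⟨by linarith [(hw.mem_Icc s y).1, (hv.mem_Icc s y).2],
      by linarith [(hw.mem_Icc s y).2, (hv.mem_Icc s y).1]⟩
  have hDb : ∀ s x, ‖expWeight δ x * |w s x - v s x|‖ ≤ expWeight δ x := fun s x => by
    rw [norm_mul, Real.norm_of_nonneg (expWeight_pos δ x).le, Real.norm_eq_abs, abs_abs]
    exact mul_le_of_le_one_right (expWeight_pos δ x).le (hD1 s x)
  have hDc : Continuous fun p : ℝ × ℝ => expWeight δ p.2 * |w p.1 p.2 - v p.1 p.2| := by
    fun_prop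
  have hDm : ∀ s, AEStronglyMeasurable (fun x => expWeight δ x * |w s x - v s x|) volume :=
    fun s => (hDc.comp (by fun_prop : Continuous fun x => (s, x))).aestronglyMeasurable
  have hDi : ∀ s, Integrable fun x => expWeight δ x * |w s x - v s x| := fun s =>
    hψi.mono' (hDm s) (Filter.Eventually.of_forall (hDb s))
  have huc : Continuous u :=
    continuous_of_dominated hDm (fun s => Filter.Eventually.of_forall (hDb s)) hψi
      (Filter.Eventually.of_forall fun x => hDc.comp (by fun_prop : Continuous fun s => (s, x)))
  set F : ℝ → ℝ → ℝ := fun s x => expWeight δ x * (Real.sign (w s x - v s x) * h s x) with hF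
  have hFm : Measurable (Function.uncurry F) :=
    ((continuous_expWeight δ).measurable.comp measurable_snd).mul
      ((Real.measurable_sign'.comp (hwc.sub hvc).measurable).mul hm)
  have hFb : ∀ s x, ‖F s x‖ ≤ expWeight δ x * (2 * c) := fun s x => by
    rw [hF]
    dsimp only
    rw [norm_mul, Real.norm_of_nonneg (expWeight_pos δ x).le, norm_mul]
    refine mul_le_mul_of_nonneg_left ?_ (expWeight_pos δ x).le
    exact (mul_le_of_le_one_left (norm_nonneg _) (Real.abs_sign_le _)).trans (hb s x)
  have hFi : ∀ t, Integrable (Function.uncurry F) ((volume.restrict (uIoc 0 t)).prod volume) :=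
    fun t => by
      have : IsFiniteMeasure (volume.restrict (uIoc 0 t)) := by
        unfold uIoc; infer_instance
      have h1 : Integrable (fun p : ℝ × ℝ => (1 : ℝ) * (expWeight δ p.2 * (2 * c)))
          ((volume.restrict (uIoc 0 t)).prod volume) :=
        Integrable.mul_prod (f := fun _ : ℝ => (1 : ℝ)) (integrable_const _) (hψi.mul_const _)
      refine h1.mono' hFm.aestronglyMeasurable (Filter.Eventually.of_forall fun p => ?_)
      rw [one_mul]
      exact hFb p.1 p.2
  refine le_mul_exp_of_le_add_integral huc (by positivity) (fun t ht => ?_) ht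
  have e1 : u t = u 0 + ∫ x, ∫ s in 0..t, F s x := by
    have j2 : Integrable fun x => ∫ s in 0..t, F s x := by
      have := (hFi t).integral_prod_right
      simpa only [uIoc_of_le ht, intervalIntegral.integral_of_le ht, Function.uncurry_apply_pair]
        using this
    rw [hu]
    dsimp only
    rw [← integral_add (hDi 0) j2]
    refine integral_congr_ae ?_
    filter_upwards [hpt] with x hx
    rw [hx t ht, hF]
    dsimp only
    rw [intervalIntegral.integral_const_mul, mul_add]
  rw [e1, ← intervalIntegral_integral_swap (hFi t), ← intervalIntegral.integral_const_mul]
  refine add_le_add le_rfl (intervalIntegral.integral_mono_on ht ?_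
    ((huc.const_mul _).intervalIntegrable _ _) fun s _ => ?_)
  · have := (hFi t).integral_prod_left
    rwa [uIoc_of_le ht, ← IntegrableOn, ← intervalIntegrable_iff_integrableOn_Ioc_of_le ht] at this
  · exact integral_sign_mul_deriv_impactFlux_le hε hV ha hL (hCw s) (hCv s) (hw.mem_Icc s)
      (hv.mem_Icc s) hδ hεδ

/-- The `L¹` contraction for solutions of the equation for the impact. -/
theorem IsImpactSolution.eLpNorm_sub_le (hw : IsImpactSolution V ε w)
    (hv : IsImpactSolution V ε v) (hε : 0 < ε) (hV : LipschitzWith K V) (ha : Antitone V)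
    (hL : ∀ x, |V x| ≤ L) (h0 : Integrable fun x => w 0 x - v 0 x) {t : ℝ} (ht : 0 ≤ t) :
    eLpNorm (fun x => w t x - v t x) 1 volume ≤ eLpNorm (fun x => w 0 x - v 0 x) 1 volume := by
  have hwc : Continuous fun p : ℝ × ℝ => w p.1 p.2 := hw.continuous
  have hvc : Continuous fun p : ℝ × ℝ => v p.1 p.2 := hv.continuous
  have hDc : Continuous fun x => |w t x - v t x| :=
    ((hwc.sub hvc).abs).comp (by fun_prop : Continuous fun x => (t, x))
  have hD1 : ∀ s y, |w s y - v s y| ≤ 1 := fun s y =>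
    abs_le.2 ⟨by linarith [(hw.mem_Icc s y).1, (hv.mem_Icc s y).2],
      by linarith [(hw.mem_Icc s y).2, (hv.mem_Icc s y).1]⟩
  -- The factor `1/(2ε)` ensures `2εδ ≤ 1` already for `n = 0`.
  set δ : ℕ → ℝ := fun n => 1 / (2 * ε) * (1 / ((n : ℝ) + 1)) with hδ
  have hδ0 : ∀ n, 0 < δ n := fun n => by positivity
  have hδε : ∀ n, 2 * (ε * δ n) ≤ 1 := fun n => by
    have h1 : 2 * (ε * δ n) = 1 / ((n : ℝ) + 1) := by
      rw [hδ]; field_simp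
    rw [h1, div_le_one (by positivity)]
    linarith [(Nat.cast_nonneg n : (0 : ℝ) ≤ n)]
  have hδt : Filter.Tendsto δ Filter.atTop (nhds 0) := by
    have := (tendsto_one_div_add_atTop_nhds_zero_nat (𝕜 := ℝ)).const_mul (1 / (2 * ε))
    rwa [mul_zero] at this
  set I := ∫ x, |w 0 x - v 0 x| with hI
  have hbound : ∀ n, ∫⁻ x, ENNReal.ofReal (expWeight (δ n) x * |w t x - v t x|) ≤
      ENNReal.ofReal (I * Real.exp ((L + 4 * K) * δ n * t)) := fun n => by
    have hψi := integrable_expWeight (hδ0 n)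
    have hi : Integrable fun x => expWeight (δ n) x * |w t x - v t x| :=
      hψi.mul_bdd (c := 1) hDc.aestronglyMeasurable (Filter.Eventually.of_forall fun x => by
        rw [Real.norm_eq_abs, abs_abs]; exact hD1 t x)
    rw [← ofReal_integral_eq_lintegral_ofReal hi (Filter.Eventually.of_forall fun x =>
      mul_nonneg (expWeight_pos _ x).le (abs_nonneg _))]
    refine ENNReal.ofReal_le_ofReal ((hw.integral_expWeight_mul_abs_sub_le hv hε hV ha hL (hδ0 n)
      (hδε n) ht).trans (mul_le_mul_of_nonneg_right ?_ (Real.exp_pos _).le))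
    refine integral_mono_of_nonneg (Filter.Eventually.of_forall fun x =>
      mul_nonneg (expWeight_pos _ x).le (abs_nonneg _)) h0.abs
      (Filter.Eventually.of_forall fun x => ?_)
    exact mul_le_of_le_one_left (abs_nonneg _) (expWeight_le_one (hδ0 n).le x)
  have hlim : Filter.Tendsto (fun n => ENNReal.ofReal (I * Real.exp ((L + 4 * K) * δ n * t)))
      Filter.atTop (nhds (ENNReal.ofReal I)) := by
    refine ENNReal.tendsto_ofReal ?_
    have h1 := ((((hδt.const_mul (L + 4 * K)).mul_const t).rexp).const_mul I)
    simpa using h1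
  have hlimD : ∀ x, Filter.Tendsto (fun n => ENNReal.ofReal (expWeight (δ n) x * |w t x - v t x|))
      Filter.atTop (nhds (ENNReal.ofReal |w t x - v t x|)) := fun x => by
    refine ENNReal.tendsto_ofReal ?_
    have h1 := (((hδt.mul_const |x|).neg).rexp).mul_const |w t x - v t x|
    simpa [expWeight] using h1
  rw [eLpNorm_one_eq_lintegral_enorm, eLpNorm_one_eq_lintegral_enorm]
  have e0 : ∫⁻ x, ‖w 0 x - v 0 x‖ₑ = ENNReal.ofReal I := by
    rw [hI, ofReal_integral_eq_lintegral_ofReal h0.abs (Filter.Eventually.of_forall fun x =>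
      abs_nonneg _)]
    simp only [← Real.norm_eq_abs, ofReal_norm]
  have et : ∫⁻ x, ‖w t x - v t x‖ₑ =
      ∫⁻ x, Filter.liminf (fun n => ENNReal.ofReal (expWeight (δ n) x * |w t x - v t x|))
        Filter.atTop := by
    refine lintegral_congr fun x => ?_
    rw [(hlimD x).liminf_eq, ← Real.norm_eq_abs, ofReal_norm]
  -- Fatou's lemma, since integrability of `w t - v t` is not yet known.
  rw [e0, et, ← hlim.liminf_eq]
  refine (lintegral_liminf_le fun n => ?_).trans
    (Filter.liminf_le_liminf (Filter.Eventually.of_forall hbound))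
  exact (((continuous_expWeight _).mul hDc).measurable).ennreal_ofReal

end

/-! ### Extension of the velocity to the real line -/

/-- The velocity, extended from `[0, 1]` to the real line by constants. -/
noncomputable def clampedVelocity (V : ℝ → ℝ) (x : ℝ) : ℝ := V (max 0 (min 1 x))

theorem clamp_mem_Icc (x : ℝ) : max 0 (min 1 x) ∈ Icc (0 : ℝ) 1 :=
  ⟨le_max_left _ _, max_le zero_le_one (min_le_left _ _)⟩

theorem clampedVelocity_of_mem (V : ℝ → ℝ) {x : ℝ} (hx : x ∈ Icc (0 : ℝ) 1) :
    clampedVelocity V x = V x := by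
  rw [clampedVelocity, min_eq_right hx.2, max_eq_right hx.1]

theorem IsVelocity.antitone_clampedVelocity {V : ℝ → ℝ} (hV : IsVelocity V) :
    Antitone (clampedVelocity V) := fun x y hxy =>
  hV.antitone (clamp_mem_Icc x) (clamp_mem_Icc y) (max_le_max le_rfl (min_le_min le_rfl hxy))

theorem IsVelocity.exists_lipschitzWith {V : ℝ → ℝ} (hV : IsVelocity V) :
    ∃ K, LipschitzWith K (clampedVelocity V) := by
  obtain ⟨K, hK⟩ := hV.lipschitz
  have h1 : LipschitzWith 1 fun x : ℝ => max 0 (min 1 x) :=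
    (LipschitzWith.id.const_min 1).const_max 0
  refine ⟨K * 1, LipschitzOnWith.comp (s := univ) (t := Icc 0 1) hK h1.lipschitzOnWith ?_ |>
    lipschitzOnWith_univ.1⟩
  exact fun x _ => clamp_mem_Icc x

theorem IsVelocity.exists_bound {V : ℝ → ℝ} (hV : IsVelocity V) :
    ∃ L, ∀ x, |clampedVelocity V x| ≤ L := by
  refine ⟨max |V 0| |V 1|, fun x => abs_le_max_abs_abs ?_ ?_ |>.trans (le_of_eq (max_comm _ _))⟩
  · exact hV.antitone (clamp_mem_Icc x) ⟨zero_le_one, le_rfl⟩ (clamp_mem_Icc x).2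
  · exact hV.antitone ⟨le_rfl, zero_le_one⟩ (clamp_mem_Icc x) (clamp_mem_Icc x).1

/-- The impact stays in `[0, 1]`, where clamping changes nothing; the velocity may thus be taken
globally Lipschitz, bounded and nonincreasing. -/
theorem IsWeakSolution.clampedVelocity {γ V ρ₀ : ℝ → ℝ} {ε : ℝ} {ρ : ℝ → ℝ → ℝ}
    (h : IsWeakSolution γ V ε ρ₀ ρ) : IsWeakSolution γ (clampedVelocity V) ε ρ₀ ρ where
  aestronglyMeasurable := h.aestronglyMeasurable
  aestronglyMeasurable_slice := h.aestronglyMeasurable_slice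
  bounded := h.bounded
  continuous_weakStar := h.continuous_weakStar
  impact_mem_Icc := h.impact_mem_Icc
  weak_eq φ φs φc := by
    refine Eq.trans ?_ (h.weak_eq φ φs φc)
    congr 1
    refine setIntegral_congr_fun (measurableSet_Ioi.prod MeasurableSet.univ) fun p hp => ?_
    simp only [clampedVelocity_of_mem V (h.impact_mem_Icc p.1 (le_of_lt (mem_Ioi.1 hp.1)) p.2)]

/-! ### From weak solutions to the equation for the impact -/

section

variable {V ρ₀ : ℝ → ℝ} {ε L : ℝ} {ρ : ℝ → ℝ → ℝ}

/-- The impact of a density, extended to negative times by its value at time `0`. -/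
noncomputable def extendedImpact (ε : ℝ) (ρ : ℝ → ℝ → ℝ) (t : ℝ) : ℝ → ℝ :=
  expAverage ε (ρ (max t 0))

theorem extendedImpact_of_nonneg (hε : 0 < ε) {t : ℝ} (ht : 0 ≤ t) (x : ℝ) :
    extendedImpact ε ρ t x = nonlocalImpact expKernel ε ρ t x := by
  rw [nonlocalImpact_expKernel hε, extendedImpact, max_eq_left ht]

theorem IsWeakSolution.extendedImpact_mem_Icc (h : IsWeakSolution expKernel V ε ρ₀ ρ) (hε : 0 < ε)
    (t x : ℝ) : extendedImpact ε ρ t x ∈ Icc (0 : ℝ) 1 := by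
  have h1 := h.impact_mem_Icc (max t 0) (le_max_right _ _) x
  rwa [nonlocalImpact_expKernel hε] at h1

theorem IsWeakSolution.exists_lipschitzWith_extendedImpact
    (h : IsWeakSolution expKernel V ε ρ₀ ρ) (hε : 0 < ε) :
    ∃ C, ∀ t, LipschitzWith C (extendedImpact ε ρ t) := by
  obtain ⟨M, hM⟩ := h.bounded
  exact ⟨_, fun t => lipschitzWith_expAverage hε
    (h.aestronglyMeasurable_slice _ (le_max_right _ _)) (hM _ (le_max_right _ _))⟩

/-- At fixed `x` the impact is the pairing of `ρ(t, ·)` with a translated integrable kernel, so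
weak-* continuity gives continuity in time; the Lipschitz bound in `x`, uniform in `t`, makes this
joint. -/
theorem IsWeakSolution.continuous_extendedImpact (h : IsWeakSolution expKernel V ε ρ₀ ρ)
    (hε : 0 < ε) : Continuous (Function.uncurry (extendedImpact ε ρ)) := by
  obtain ⟨C, hC⟩ := h.exists_lipschitzWith_extendedImpact hε
  have h1 : Continuous fun p : ℝ × ℝ => extendedImpact ε ρ p.2 p.1 := by
    refine continuous_prod_of_continuous_lipschitzWith _ C (fun x => ?_) hC
    simp only [extendedImpact, expAverage_eq_integral]
    exact (h.continuous_weakStar _ ((integrable_averageKernel hε).comp_sub_left x)).comp_continuous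
      (f := fun t : ℝ => max t 0) (by fun_prop) fun t => mem_Ici.2 (le_max_right _ _)
  exact h1.comp continuous_swap

theorem restrict_Ioi_prod_univ :
    (volume : Measure (ℝ × ℝ)).restrict (Ioi 0 ×ˢ univ) =
      (volume.restrict (Ioi (0 : ℝ))).prod volume := by
  rw [Measure.volume_eq_prod, ← Measure.prod_restrict, Measure.restrict_univ]

/-- The slicewise bound is transferred to the product measure through a strongly measurable
representative, for which the set where the bound holds is measurable. -/
theorem IsWeakSolution.ae_bdd (h : IsWeakSolution expKernel V ε ρ₀ ρ) {M : ℝ}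
    (hM : ∀ t, 0 ≤ t → ∀ᵐ x, |ρ t x| ≤ M) :
    ∀ᵐ p ∂((volume.restrict (Ioi (0 : ℝ))).prod volume), |ρ p.1 p.2| ≤ M := by
  have hm := h.aestronglyMeasurable
  rw [restrict_Ioi_prod_univ] at hm
  obtain ⟨g, gm, hg⟩ := hm
  have h1 := Measure.ae_ae_of_ae_prod hg
  have hs : MeasurableSet {p : ℝ × ℝ | |g p| ≤ M} :=
    measurableSet_le gm.measurable.abs measurable_const
  have h2 : ∀ᵐ p ∂((volume.restrict (Ioi (0 : ℝ))).prod volume), p ∈ {p : ℝ × ℝ | |g p| ≤ M} := by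
    rw [Measure.ae_prod_mem_iff_ae_ae_mem hs]
    filter_upwards [h1, ae_restrict_mem measurableSet_Ioi] with t ht ht0
    filter_upwards [ht, hM t (le_of_lt ht0)] with x hx hx'
    show |g (t, x)| ≤ M
    rw [← hx]
    exact hx'
  filter_upwards [hg, h2] with p hp hp'
  rw [hp]
  exact hp'

theorem fderiv_mul_prod {χ θ : ℝ → ℝ} (hχ : Differentiable ℝ χ) (hθ : Differentiable ℝ θ)
    (p : ℝ × ℝ) :
    fderiv ℝ (fun p : ℝ × ℝ => χ p.1 * θ p.2) p (1, 0) = deriv χ p.1 * θ p.2 ∧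
      fderiv ℝ (fun p : ℝ × ℝ => χ p.1 * θ p.2) p (0, 1) = χ p.1 * deriv θ p.2 := by
  have h1 := (hχ p.1).hasDerivAt.comp_hasFDerivAt p (hasFDerivAt_fst (𝕜 := ℝ))
  have h2 := (hθ p.2).hasDerivAt.comp_hasFDerivAt p (hasFDerivAt_snd (𝕜 := ℝ))
  have h3 := (h1.mul h2).fderiv
  have h4 : (fun p : ℝ × ℝ => χ p.1 * θ p.2) = (χ ∘ Prod.fst) * (θ ∘ Prod.snd) := rfl
  rw [h4, h3]
  constructor <;> simp [mul_comm]

/-- The weak formulation integrated in time, against a test function of the space variable. -/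
theorem IsWeakSolution.integral_mul_eq (h : IsWeakSolution expKernel V ε ρ₀ ρ) (hε : 0 < ε)
    (hV : Continuous V) (hL : ∀ x, |V x| ≤ L) {θ : ℝ → ℝ} (θs : ContDiff ℝ ∞ θ)
    (θc : HasCompactSupport θ) {t : ℝ} (ht : 0 ≤ t) :
    ∫ x, ρ t x * θ x = (∫ x, ρ₀ x * θ x) +
      ∫ s in 0..t, ∫ x, V (extendedImpact ε ρ s x) * ρ s x * deriv θ x := by
  obtain ⟨M, hM⟩ := h.bounded
  set μ := (volume.restrict (Ioi (0 : ℝ))).prod (volume : Measure ℝ) with hμ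
  have hρb : ∀ᵐ p ∂μ, |ρ p.1 p.2| ≤ M := h.ae_bdd hM
  have hρm : AEStronglyMeasurable (fun p : ℝ × ℝ => ρ p.1 p.2) μ := by
    have := h.aestronglyMeasurable
    rwa [restrict_Ioi_prod_univ] at this
  have hVw : Continuous fun p : ℝ × ℝ => V (extendedImpact ε ρ p.1 p.2) :=
    hV.comp (h.continuous_extendedImpact hε)
  have hfm : AEStronglyMeasurable
      (fun p : ℝ × ℝ => V (extendedImpact ε ρ p.1 p.2) * ρ p.1 p.2) μ :=
    hVw.aestronglyMeasurable.mul hρm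
  have hL0 : 0 ≤ L := (abs_nonneg _).trans (hL 0)
  have hmulb : ∀ a b, |b| ≤ M → ‖V a * b‖ ≤ L * M := fun a b hb => by
    rw [norm_mul]
    exact mul_le_mul (hL a) hb (abs_nonneg _) hL0
  have hfb : ∀ᵐ p ∂μ, ‖V (extendedImpact ε ρ p.1 p.2) * ρ p.1 p.2‖ ≤ L * M := by
    filter_upwards [hρb] with p hp using hmulb _ _ hp
  have dθs : Continuous (deriv θ) := θs.continuous_deriv (by simp)
  have θi : Integrable θ := θs.continuous.integrable_of_hasCompactSupport θc
  have dθi : Integrable (deriv θ) := dθs.integrable_of_hasCompactSupport θc.deriv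
  have hslρ : ∀ s, 0 ≤ s → Integrable fun x => ρ s x * θ x := fun s hs =>
    θi.bdd_mul (h.aestronglyMeasurable_slice s hs) (hM s hs)
  have hslf : ∀ s, 0 ≤ s →
      Integrable fun x => V (extendedImpact ε ρ s x) * ρ s x * deriv θ x := fun s hs =>
    dθi.bdd_mul ((hVw.comp (by fun_prop : Continuous fun x => (s, x))).aestronglyMeasurable.mul
      (h.aestronglyMeasurable_slice s hs)) (by
        filter_upwards [hM s hs] with x hx using hmulb _ _ hx)
  refine eq_add_integral_of_weak_deriv (a := fun t => ∫ x, ρ t x * θ x)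
    (b := fun s => ∫ x, V (extendedImpact ε ρ s x) * ρ s x * deriv θ x)
    (h.continuous_weakStar θ θi) ?_ (fun χ χs χc => ?_) ht
  · refine locallyIntegrable_of_ae_bdd (M := L * M * ∫ x, |deriv θ x|) ?_
      (Filter.Eventually.of_forall fun s => ?_)
    · rw [aestronglyMeasurable_indicator_iff measurableSet_Ioi]
      exact (hfm.mul (dθs.comp continuous_snd).aestronglyMeasurable).integral_prod_right'
    · have hM0 : 0 ≤ M := by
        obtain ⟨x, hx⟩ := (hM 0 le_rfl).exists
        exact (abs_nonneg _).trans hx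
      by_cases hs : s ∈ Ioi (0 : ℝ)
      · rw [indicator_of_mem hs, ← integral_const_mul, ← Real.norm_eq_abs]
        refine norm_integral_le_of_norm_le (dθi.abs.const_mul _) ?_
        filter_upwards [hM s (le_of_lt hs)] with x hx
        rw [norm_mul]
        exact mul_le_mul_of_nonneg_right (hmulb _ _ hx) (norm_nonneg _)
      · rw [indicator_of_notMem hs, abs_zero]
        exact mul_nonneg (mul_nonneg hL0 hM0) (integral_nonneg fun x => abs_nonneg _)
  -- Testing with a product `χ(t) θ(x)` reduces the equation to the weak form of an ordinary
  -- differential equation for `∫ ρ(t, x) θ(x) dx`.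
  · have hw := h.weak_eq (fun p : ℝ × ℝ => χ p.1 * θ p.2)
      ((χs.comp contDiff_fst).mul (θs.comp contDiff_snd))
      (HasCompactSupport.intro (χc.isCompact.prod θc.isCompact) fun p hp => by
        rw [mem_prod, not_and_or] at hp
        rcases hp with hp | hp
        · rw [image_eq_zero_of_notMem_tsupport hp, zero_mul]
        · rw [image_eq_zero_of_notMem_tsupport hp, mul_zero])
    have χi : Integrable χ (volume.restrict (Ioi 0)) :=
      (χs.continuous.integrable_of_hasCompactSupport χc).restrict
    have dχi : Integrable (deriv χ) (volume.restrict (Ioi 0)) :=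
      ((χs.continuous_deriv (by simp)).integrable_of_hasCompactSupport χc.deriv).restrict
    have I1 : Integrable (fun p : ℝ × ℝ => ρ p.1 p.2 * (deriv χ p.1 * θ p.2)) μ :=
      (dχi.mul_prod θi).bdd_mul hρm hρb
    have I2 : Integrable (fun p : ℝ × ℝ => V (extendedImpact ε ρ p.1 p.2) * ρ p.1 p.2 *
        (χ p.1 * deriv θ p.2)) μ :=
      (χi.mul_prod dθi).bdd_mul hfm hfb
    have e1 : ∫ p in (Ioi (0 : ℝ)) ×ˢ (univ : Set ℝ),
        (ρ p.1 p.2 * fderiv ℝ (fun p : ℝ × ℝ => χ p.1 * θ p.2) p (1, 0) +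
          V (nonlocalImpact expKernel ε ρ p.1 p.2) * ρ p.1 p.2 *
            fderiv ℝ (fun p : ℝ × ℝ => χ p.1 * θ p.2) p (0, 1)) =
        ∫ p, (ρ p.1 p.2 * (deriv χ p.1 * θ p.2) +
          V (extendedImpact ε ρ p.1 p.2) * ρ p.1 p.2 * (χ p.1 * deriv θ p.2)) ∂μ := by
      rw [hμ, ← restrict_Ioi_prod_univ]
      refine setIntegral_congr_fun (measurableSet_Ioi.prod MeasurableSet.univ) fun p hp => ?_
      have hd := fderiv_mul_prod (χs.differentiable (by simp)) (θs.differentiable (by simp)) p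
      simp only [hd.1, hd.2, extendedImpact_of_nonneg hε (le_of_lt (mem_Ioi.1 hp.1))]
    have I3 : Integrable (fun p : ℝ × ℝ => ρ p.1 p.2 * (deriv χ p.1 * θ p.2) +
        V (extendedImpact ε ρ p.1 p.2) * ρ p.1 p.2 * (χ p.1 * deriv θ p.2)) μ := I1.add I2
    rw [e1, integral_prod _ I3] at hw
    have e2 : ∫ s in Ioi 0, ∫ x, (ρ s x * (deriv χ s * θ x) +
          V (extendedImpact ε ρ s x) * ρ s x * (χ s * deriv θ x)) =
        ∫ s in Ioi 0, ((∫ x, ρ s x * θ x) * deriv χ s +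
          (∫ x, V (extendedImpact ε ρ s x) * ρ s x * deriv θ x) * χ s) := by
      refine setIntegral_congr_fun measurableSet_Ioi fun s hs => ?_
      have hs0 : 0 ≤ s := le_of_lt hs
      rw [← integral_mul_const, ← integral_mul_const, ← integral_add
        ((hslρ s hs0).mul_const _) ((hslf s hs0).mul_const _)]
      congr 1
      ext x
      ring
    rw [← e2]
    refine Eq.trans ?_ hw
    congr 1
    rw [← integral_mul_const]
    congr 1
    ext x
    ring

/-- This is the time-integrated weak formulation at `t = 0`, where the flux term is an integral over
an empty interval. -/
theorem IsWeakSolution.ae_eq_initial (h : IsWeakSolution expKernel V ε ρ₀ ρ) (hε : 0 < ε)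
    (hV : Continuous V) (hL : ∀ x, |V x| ≤ L) (hρ₀ : LocallyIntegrable ρ₀) :
    ρ 0 =ᵐ[volume] ρ₀ := by
  obtain ⟨M, hM⟩ := h.bounded
  refine ae_eq_of_integral_contDiff_smul_eq
    (locallyIntegrable_of_ae_bdd (h.aestronglyMeasurable_slice 0 le_rfl) (hM 0 le_rfl)) hρ₀
    fun θ θs θc => ?_
  have := h.integral_mul_eq hε hV hL θs θc le_rfl
  rw [intervalIntegral.integral_same, add_zero] at this
  simpa only [smul_eq_mul, mul_comm] using this

/-- The nonlocal impact of a weak solution solves the equation for the impact. -/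
theorem IsWeakSolution.isImpactSolution (h : IsWeakSolution expKernel V ε ρ₀ ρ) (hε : 0 < ε)
    (hV : Continuous V) (hL : ∀ x, |V x| ≤ L) :
    IsImpactSolution V ε (extendedImpact ε ρ) := by
  obtain ⟨M, hM⟩ := h.bounded
  set w := extendedImpact ε ρ with hw
  have w1 : ∀ t x, w t x ∈ Icc (0 : ℝ) 1 := h.extendedImpact_mem_Icc hε
  have wc : Continuous (Function.uncurry w) := h.continuous_extendedImpact hε
  obtain ⟨C, wl⟩ : ∃ C, ∀ t, LipschitzWith C (w t) := h.exists_lipschitzWith_extendedImpact hε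
  refine ⟨wc, ⟨C, wl⟩, w1, ?_⟩
  have hL0 : 0 ≤ L := (abs_nonneg _).trans (hL 0)
  set p : ℝ → ℝ → ℝ := fun s => impactFlux V ε (w s) with hp
  set c : NNReal := L.toNNReal * C + (2 * (2 * L) / ε).toNNReal with hc
  have pl : ∀ s, LipschitzWith c (p s) := fun s => lipschitzWith_impactFlux hε hV hL (wl s) (w1 s)
  have pm : Measurable fun q : ℝ × ℝ => deriv (p q.1) q.2 :=
    measurable_deriv_with_param (continuous_impactFlux hε hV hL wc w1)
  have pb : ∀ s x, |deriv (p s) x| ≤ c := fun s x => norm_deriv_le_of_lipschitz (pl s)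
  have pmx : ∀ x, Measurable fun s => deriv (p s) x := fun x =>
    pm.comp (g := fun q : ℝ × ℝ => deriv (p q.1) q.2)
      (f := fun s => (s, x)) (measurable_id.prodMk measurable_const)
  have pii : ∀ x a b, IntervalIntegrable (fun s => deriv (p s) x) volume a b := fun x a b =>
    (intervalIntegrable_const (c := (c : ℝ))).mono_fun (pmx x).aestronglyMeasurable
      (Filter.Eventually.of_forall fun s => by simpa using pb s x)
  -- the identities relating density, impact and flux at a fixed time
  have hslice : ∀ s, 0 ≤ s → ∀ᵐ x, ρ s x = w s x - ε * deriv (w s) x ∧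
      V (w s x) * ρ s x = p s x - ε * deriv (p s) x := fun s hs => by
    have hws : w s = expAverage ε (ρ s) := by rw [hw, extendedImpact, max_eq_left hs]
    filter_upwards [ae_hasDerivAt_expAverage hε (h.aestronglyMeasurable_slice s hs) (hM s hs),
      ae_hasDerivAt_impactFlux hε hV hL (wl s) (w1 s)] with x h1 h2
    rw [← hws] at h1
    have e1 : ε * deriv (w s) x = w s x - ρ s x := by
      rw [h1.deriv]
      field_simp
    have e2 : ε * deriv (p s) x = V (w s x) * (ε * deriv (w s) x) +
        (expAverage ε (fun y => relaxation V (w s y)) x - relaxation V (w s x)) := by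
      rw [h2.2.deriv]
      field_simp
    refine ⟨by rw [e1]; ring, ?_⟩
    rw [e2, e1, hp]
    simp only [impactFlux, relaxation]
    ring
  have hpt : ∀ t, 0 ≤ t → ∀ᵐ x, w t x = w 0 x - ∫ s in 0..t, deriv (p s) x := fun t ht => by
    set N : ℝ → ℝ := fun x => w t x - w 0 x + ∫ s in 0..t, deriv (p s) x with hN
    have Jm : AEStronglyMeasurable (fun x => ∫ s in 0..t, deriv (p s) x) volume := by
      simp only [intervalIntegral.integral_of_le ht]
      exact (pm.comp measurable_swap).stronglyMeasurable.integral_prod_right'.aestronglyMeasurable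
    have Jb : ∀ x, |∫ s in 0..t, deriv (p s) x| ≤ c * t := fun x => by
      have := intervalIntegral.norm_integral_le_of_norm_le_const (a := 0) (b := t)
        (f := fun s => deriv (p s) x) fun s _ => pb s x
      rwa [sub_zero, abs_of_nonneg ht] at this
    have wcs : ∀ s, Continuous (w s) := fun s => (wl s).continuous
    have Nb : ∀ x, |N x| ≤ 1 + c * t := fun x => by
      refine (abs_add_le _ _).trans (add_le_add ?_ (Jb x))
      exact abs_le.2 ⟨by linarith [(w1 t x).1, (w1 0 x).2], by linarith [(w1 t x).2, (w1 0 x).1]⟩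
    have Nm : AEStronglyMeasurable N volume :=
      ((wcs t).sub (wcs 0)).aestronglyMeasurable.add Jm
    -- The operator `1 + ε ∂ₓ` on test functions is the adjoint of `1 - ε ∂ₓ`, which takes `w` to
    -- `ρ` and the impact flux to `V(w) ρ`. The weak equation for `ρ` therefore says that the defect
    -- `N` satisfies `N - ε N' = 0` in the sense of distributions.
    have hweak : ∀ θ : ℝ → ℝ, ContDiff ℝ ∞ θ → HasCompactSupport θ →
        ∫ x, N x * (θ x + ε * deriv θ x) = 0 := fun θ θs θc => by
      have dθs : ContDiff ℝ ∞ (deriv θ) := (contDiff_infty_iff_deriv.1 θs).2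
      have dθc : HasCompactSupport (deriv θ) := θc.deriv
      have θi : Integrable θ := θs.continuous.integrable_of_hasCompactSupport θc
      have dθi : Integrable (deriv θ) := dθs.continuous.integrable_of_hasCompactSupport dθc
      set g : ℝ → ℝ := fun x => θ x + ε * deriv θ x with hg
      have gi : Integrable g := θi.add (dθi.const_mul ε)
      have bi : ∀ (f η : ℝ → ℝ) (B : ℝ), AEStronglyMeasurable f volume → (∀ x, |f x| ≤ B) →
          Integrable η → Integrable fun x => f x * η x := fun f η B hf hB hη =>
        hη.bdd_mul hf (Filter.Eventually.of_forall hB)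
      have w1' : ∀ s x, |w s x| ≤ 1 := fun s x => by
        rw [abs_of_nonneg (w1 s x).1]; exact (w1 s x).2
      have dwb : ∀ s x, |deriv (w s) x| ≤ C := fun s x => norm_deriv_le_of_lipschitz (wl s)
      have pcs : ∀ s, Continuous (p s) := fun s => (pl s).continuous
      have hρ : ∀ s, 0 ≤ s → ∫ x, ρ s x * θ x = ∫ x, w s x * g x := fun s hs => by
        have i1 := bi (w s) θ 1 (wcs s).aestronglyMeasurable (w1' s) θi
        have i2 := bi (deriv (w s)) θ C (measurable_deriv _).aestronglyMeasurable (dwb s) θi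
        have i3 := bi (w s) (deriv θ) 1 (wcs s).aestronglyMeasurable (w1' s) dθi
        have ibp := integral_deriv_mul_eq_neg_of_lipschitz (wl s) (θs.of_le (by simp)) θc
        calc ∫ x, ρ s x * θ x = ∫ x, (w s x * θ x - ε * (deriv (w s) x * θ x)) := by
              refine integral_congr_ae ?_
              filter_upwards [hslice s hs] with x hx
              rw [hx.1]; ring
          _ = (∫ x, w s x * θ x) + ε * ∫ x, w s x * deriv θ x := by
              rw [integral_sub i1 (i2.const_mul ε), integral_const_mul, ibp]; ring
          _ = ∫ x, w s x * g x := by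
              rw [← integral_const_mul, ← integral_add i1 (i3.const_mul ε)]
              congr 1; ext x; rw [hg]; ring
      have hf : ∀ s, 0 ≤ s →
          ∫ x, V (w s x) * ρ s x * deriv θ x = -∫ x, deriv (p s) x * g x := fun s hs => by
        have i1 : Integrable fun x => p s x * deriv θ x :=
          ((pcs s).mul dθs.continuous).integrable_of_hasCompactSupport dθc.mul_left
        have i2 := bi (deriv (p s)) (deriv θ) c (measurable_deriv _).aestronglyMeasurable (pb s) dθi
        have i3 := bi (deriv (p s)) θ c (measurable_deriv _).aestronglyMeasurable (pb s) θi
        have ibp := integral_deriv_mul_eq_neg_of_lipschitz (pl s) (θs.of_le (by simp)) θc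
        calc ∫ x, V (w s x) * ρ s x * deriv θ x =
            ∫ x, (p s x * deriv θ x - ε * (deriv (p s) x * deriv θ x)) := by
              refine integral_congr_ae ?_
              filter_upwards [hslice s hs] with x hx
              rw [hx.2]; ring
          _ = -((∫ x, deriv (p s) x * θ x) + ε * ∫ x, deriv (p s) x * deriv θ x) := by
              rw [integral_sub i1 (i2.const_mul ε), integral_const_mul, ibp]; ring
          _ = -∫ x, deriv (p s) x * g x := by
              rw [← integral_const_mul, ← integral_add i3 (i2.const_mul ε)]
              congr 2; ext x; rw [hg]; ring
      have et := h.integral_mul_eq hε hV hL θs θc ht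
      have e0 := h.integral_mul_eq hε hV hL θs θc le_rfl
      rw [intervalIntegral.integral_same, add_zero] at e0
      rw [← e0, hρ t ht, hρ 0 le_rfl] at et
      have e3 : ∫ s in 0..t, ∫ x, V (w s x) * ρ s x * deriv θ x =
          -∫ x, (∫ s in 0..t, deriv (p s) x) * g x := by
        have hFi : Integrable (Function.uncurry fun s x => deriv (p s) x * g x)
            ((volume.restrict (uIoc 0 t)).prod volume) := by
          have : IsFiniteMeasure (volume.restrict (uIoc 0 t)) := by
            unfold uIoc; infer_instance
          have h1 : Integrable (fun q : ℝ × ℝ => (1 : ℝ) * g q.2)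
              ((volume.restrict (uIoc 0 t)).prod volume) :=
            Integrable.mul_prod (f := fun _ : ℝ => (1 : ℝ)) (integrable_const _) gi
          simp only [one_mul] at h1
          exact h1.bdd_mul pm.aestronglyMeasurable (Filter.Eventually.of_forall fun q => pb q.1 q.2)
        have e4 : ∫ s in 0..t, ∫ x, V (w s x) * ρ s x * deriv θ x =
            ∫ s in 0..t, -∫ x, deriv (p s) x * g x := by
          refine intervalIntegral.integral_congr fun s hs => ?_
          rw [uIcc_of_le ht] at hs
          exact hf s hs.1
        rw [e4, intervalIntegral.integral_neg, intervalIntegral_integral_swap hFi]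
        simp only [intervalIntegral.integral_mul_const]
      rw [e3] at et
      have i1 := bi (w t) g 1 (wcs t).aestronglyMeasurable (w1' t) gi
      have i2 := bi (w 0) g 1 (wcs 0).aestronglyMeasurable (w1' 0) gi
      have i3 := bi _ g (c * t) Jm Jb gi
      have e5 : ∫ x, N x * g x = (∫ x, w t x * g x) - (∫ x, w 0 x * g x) +
          ∫ x, (∫ s in 0..t, deriv (p s) x) * g x := by
        have i12 : Integrable fun x => w t x * g x - w 0 x * g x := i1.sub i2
        rw [← integral_sub i1 i2, ← integral_add i12 i3]
        congr 1; ext x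
        simp only [hN]
        ring
      rw [e5, et]
      ring
    -- multiplying by the integrating factor
    obtain ⟨a, ha⟩ := ae_eq_const_of_integral_mul_deriv_eq_zero
      (n := fun x => Real.exp (-x / ε) * N x)
      ((locallyIntegrable_of_ae_bdd Nm (Filter.Eventually.of_forall Nb)).continuous_mul
        (by fun_prop)) fun ζ ζs ζc => by
        have hexp : ContDiff ℝ ∞ fun x : ℝ => Real.exp (-x / ε) := by fun_prop
        have h1 := hweak (fun x => Real.exp (-x / ε) * ζ x) (hexp.mul ζs) ζc.mul_left
        have h2 : ∀ x, deriv (fun x => Real.exp (-x / ε) * ζ x) x =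
            Real.exp (-x / ε) * (-1 / ε) * ζ x + Real.exp (-x / ε) * deriv ζ x := fun x =>
          ((((hasDerivAt_id x).neg.div_const ε).exp).mul
            (ζs.differentiable (by simp) x).hasDerivAt).deriv
        have h3 : ∀ x, N x * (Real.exp (-x / ε) * ζ x +
            ε * deriv (fun x => Real.exp (-x / ε) * ζ x) x) =
            ε * (Real.exp (-x / ε) * N x * deriv ζ x) := fun x => by
          rw [h2]; field_simp; ring
        simp only [h3] at h1
        rw [integral_const_mul] at h1
        exact (mul_eq_zero.1 h1).resolve_left hε.ne'
    -- The solutions of `N - ε N' = 0` are the multiples of `exp(x/ε)`; boundedness of `N` as `x →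
    -- ∞` leaves only zero.
    have ha0 : a = 0 := by
      have hlim : Filter.Tendsto (fun x : ℝ => Real.exp (-x / ε) * (1 + c * t)) Filter.atTop
          (nhds 0) := by
        have h1 : Filter.Tendsto (fun x : ℝ => Real.exp (-(x / ε))) Filter.atTop (nhds 0) :=
          Real.tendsto_exp_neg_atTop_nhds_zero.comp (Filter.tendsto_id.atTop_div_const hε)
        simpa only [neg_div, zero_mul] using h1.mul_const (1 + c * t)
      by_contra hne
      obtain ⟨X, hX⟩ := Filter.eventually_atTop.1 (hlim.eventually_lt_const (abs_pos.2 hne))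
      have hfalse : ∀ᵐ x ∂(volume.restrict (Ioi X)), False := by
        filter_upwards [ae_restrict_of_ae ha, ae_restrict_mem measurableSet_Ioi] with x hx hxX
        have h1 := hX x (le_of_lt hxX)
        rw [← hx, abs_mul, abs_of_pos (Real.exp_pos _)] at h1
        exact absurd (mul_le_mul_of_nonneg_left (Nb x) (Real.exp_pos (-x / ε)).le) (not_le.2 h1)
      have hne0 : volume.restrict (Ioi X) ≠ 0 := by simp
      have : (ae (volume.restrict (Ioi X))).NeBot := ae_neBot.2 hne0
      exact hfalse.exists.choose_spec
    filter_upwards [ha] with x hx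
    rw [ha0] at hx
    have h1 := (mul_eq_zero.1 hx).resolve_left (Real.exp_pos _).ne'
    rw [hN] at h1
    dsimp only at h1
    linarith
  -- The exceptional null set of `hpt` depends on `t`. Rational times give one common null set, and
  -- continuity in `t` of both sides extends the identity to all nonnegative times.
  have hall : ∀ᵐ x, ∀ q : ℚ,
      w (max (q : ℝ) 0) x = w 0 x - ∫ s in 0..(max (q : ℝ) 0), deriv (p s) x :=
    ae_all_iff.2 fun q => hpt _ (le_max_right _ _)
  filter_upwards [hall] with x hx t ht
  have c1 : Continuous fun t : ℝ => w (max t 0) x :=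
    wc.comp (by fun_prop : Continuous fun t : ℝ => (max t 0, x))
  have c2 : Continuous fun t : ℝ => w 0 x - ∫ s in 0..(max t 0), deriv (p s) x :=
    continuous_const.sub ((intervalIntegral.continuous_primitive (pii x) 0).comp (by fun_prop))
  have h1 := congrFun (Rat.denseRange_cast.equalizer c1 c2 (funext hx)) t
  simpa only [max_eq_left ht] using h1

end

/-! ### Conclusion -/

theorem IsInitialDatum.locallyIntegrable {ρ₀ : ℝ → ℝ} (h : IsInitialDatum ρ₀) :
    LocallyIntegrable ρ₀ :=
  locallyIntegrable_of_ae_bdd h.memLp_top.1 (M := 1) (by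
    filter_upwards [h.mem_Icc] with x hx
    rw [abs_of_nonneg hx.1]
    exact hx.2)

theorem theorem4p6 (V : ℝ → ℝ) (hV : IsVelocity V) (ε : ℝ) (hε : 0 < ε)
    (ρ₀ ρ₀' : ℝ → ℝ) (h₀ : IsInitialDatum ρ₀) (h₀' : IsInitialDatum ρ₀')
    (hdiff : Integrable (fun x => ρ₀ x - ρ₀' x) volume)
    (ρ ρ' : ℝ → ℝ → ℝ)
    (hρ : IsWeakSolution expKernel V ε ρ₀ ρ) (hρ' : IsWeakSolution expKernel V ε ρ₀' ρ')
    (t : ℝ) (ht : 0 ≤ t) :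
    Integrable (fun x => nonlocalImpact expKernel ε ρ t x - nonlocalImpact expKernel ε ρ' t x)
        volume ∧
      eLpNorm (fun x => nonlocalImpact expKernel ε ρ t x - nonlocalImpact expKernel ε ρ' t x)
          1 volume ≤
        eLpNorm (fun x => nonlocalImpact expKernel ε ρ 0 x - nonlocalImpact expKernel ε ρ' 0 x)
          1 volume := by
  obtain ⟨K, hK⟩ := hV.exists_lipschitzWith
  obtain ⟨L, hL⟩ := hV.exists_bound
  have hVc := hK.continuous
  have g := hρ.clampedVelocity
  have g' := hρ'.clampedVelocity
  have s := g.isImpactSolution hε hVc hL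
  have s' := g'.isImpactSolution hε hVc hL
  obtain ⟨M, hM⟩ := g.bounded
  obtain ⟨M', hM'⟩ := g'.bounded
  have hinit : Integrable fun x => extendedImpact ε ρ 0 x - extendedImpact ε ρ' 0 x := by
    have e1 : (fun x => extendedImpact ε ρ 0 x - extendedImpact ε ρ' 0 x) =
        expAverage ε fun x => ρ 0 x - ρ' 0 x := by
      ext x
      rw [expAverage_sub hε (g.aestronglyMeasurable_slice 0 le_rfl) (hM 0 le_rfl)
        (g'.aestronglyMeasurable_slice 0 le_rfl) (hM' 0 le_rfl), extendedImpact, extendedImpact,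
        max_self]
    rw [e1]
    -- The initial difference of impacts is the average of `ρ₀ - ρ₀'`, and averaging preserves
    -- integrability.
    refine integrable_expAverage hε (hdiff.congr ?_)
    filter_upwards [g.ae_eq_initial hε hVc hL h₀.locallyIntegrable,
      g'.ae_eq_initial hε hVc hL h₀'.locallyIntegrable] with x hx hx'
    rw [hx, hx']
  have key := s.eLpNorm_sub_le s' hε hK hV.antitone_clampedVelocity hL hinit ht
  simp only [← extendedImpact_of_nonneg hε ht, ← extendedImpact_of_nonneg hε le_rfl]
  refine ⟨memLp_one_iff_integrable.1 ⟨?_, key.trans_lt (memLp_one_iff_integrable.2 hinit).2⟩, key⟩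
  obtain ⟨C, hC⟩ := s.lipschitz
  obtain ⟨C', hC'⟩ := s'.lipschitz
  exact ((hC t).continuous.sub (hC' t).continuous).aestronglyMeasurable
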